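/- Let $s\in(0,1)$, let $N\in\mathbb N$ with $N>2s$, and let $m>0$. Put $2^*_s=\frac{2N}{N-2s}$. Let $g:\mathbb R\to\mathbb R$ be continuous with $g(0)=0$, $$\limsup_{t\to0}\frac{g(t)}{t}\le 0,\qquad \limsup_{|t|\to\infty}\frac{|g(t)|}{|t|^{2^*_s-1}}<\infty,$$ and let $G(t)=\int_0^t g(\tau)\,d\tau$. Let $H^s(\mathbb R^N)=\{u\in L^2(\mathbb R^N;\mathbb R)\mid |\cdot|^s\widehat u\in L^2(\mathbb R^N)\}$, and for $u\in H^s(\mathbb R^N)$, $\mu\in\mathbb R$ define, with values in $\mathbb R\cup\{+\infty\}$, $$K(u)=\tfrac12\int_{\mathbb R^N}|(-\Delta)^{s/2}u|^2\,dx-\int_{\mathbb R^N}G(u)\,dx,$$ $$I^m(\mu,u)=\tfrac12\int_{\mathbb R^N}|(-\Delta)^{s/2}u|^2\,dx+\tfrac\mu2\Big(\int_{\mathbb R^N}u^2\,dx-m\Big)-\int_{\mathbb R^N}G(u)\,dx,$$ $$P(\mu,u)=\int_{\mathbb R^N}|(-\Delta)^{s/2}u|^2\,dx+2^*_s\int_{\mathbb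 R^N}\Big(\tfrac\mu2u^2-G(u)\Big)\,dx,$$ where the positive part of $G(u)$ is always integrable and $\int G(u)=-\infty$ is allowed. Let $\mathcal S_m=\{u\in H^s(\mathbb R^N)\mid\int u^2=m\}$ and, for $\rho\in[-\infty,+\infty)$, $$\mathcal P_{(\rho)}=\{(\mu,u)\in(\rho,+\infty)\times H^s(\mathbb R^N)\mid u\neq0,\ P(\mu,u)=0\}.$$ Let $u\in\mathcal S_m$ satisfy $K(u)=\inf_{\mathcal S_m}K$. Then there is $\mu\in\mathbb R$ such that: 1. $u$ is a weak solution of $(-\Delta)^su+\mu u=g(u)$ in $\mathbb R^N$, that is, for every $\varphi\in H^s(\mathbb R^N)\cap L^1(\mathbb R^N)$ the function $g(u)\varphi$ is integrable and $$\int_{\mathbb R^N}(-\Delta)^{s/2}u\,(-\Delta)^{s/2}\varphi\,dx+\mu\int_{\mathbb R^N}u\varphi\,dx=\int_{\mathbb R^N}g(u)\varphi\,dx;$$ 2. $(\mu,u)$ satisfies the Pohožaev identity (in particular $\int G(u)$ is finite) $$\frac1{2^*_s}\int_{\mathbb R^N}|(-\Delta)^{s/2}u|^2\,dx+\frac\mu2\int_{\mathbb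 R^N}u^2\,dx-\int_{\mathbb R^N}G(u)\,dx=0;$$ 3. for every $\rho\in\big[-\infty,-\tfrac2m\inf_{\mathcal S_m}K\big)$, $$K(u)=I^m(\mu,u)=\inf_{\mathcal P_{(\rho)}}I^m.$$ -/

import Mathlib

open MeasureTheory Filter Topology
open scoped FourierTransform ENNReal

noncomputable section

namespace FracNLS

/-- The space `ℝ^N` with its Euclidean norm and Lebesgue measure. -/
abbrev E (N : ℕ) := EuclideanSpace ℝ (Fin N)

/-- Real `L²(ℝ^N)`. -/
abbrev L2 (N : ℕ) := Lp ℝ 2 (volume : Measure (E N))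

/-- The `L²` Fourier transform (kernel `e^{-2πi x·ξ}`) of a real function in `L²(ℝ^N)`. -/
def fourierL2 {N : ℕ} (u : L2 N) : Lp ℂ 2 (volume : Measure (E N)) :=
  𝓕 (Complex.ofRealCLM.compLpL 2 (volume : Measure (E N)) u)

/-- `ξ ↦ |2πξ|^s û(ξ)`. With the kernel `e^{-2πi x·ξ}` the symbol of `-Δ` is `|2πξ|²`, so this is
the Fourier transform of `(-Δ)^{s/2} u`. -/
def symbolMul {N : ℕ} (s : ℝ) (u : L2 N) (ξ : E N) : ℂ :=
  (((2 * Real.pi * ‖ξ‖) ^ s : ℝ) : ℂ) * fourierL2 u ξ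

lemma symbolMul_zero {N : ℕ} (s : ℝ) : symbolMul s (0 : L2 N) =ᵐ[volume] 0 := by
  have h : fourierL2 (0 : L2 N) = 0 := by
    simp only [fourierL2, map_zero]
    exact (Lp.fourierTransformₗᵢ (E N) ℂ).map_zero
  filter_upwards [Lp.coeFn_zero ℂ 2 (volume : Measure (E N))] with ξ hξ
  simp only [symbolMul, h]
  rw [hξ]
  simp

lemma symbolMul_add {N : ℕ} (s : ℝ) (u v : L2 N) :
    symbolMul s (u + v) =ᵐ[volume] symbolMul s u + symbolMul s v := by
  have h : fourierL2 (u + v) = fourierL2 u + fourierL2 v := by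
    simp only [fourierL2, map_add]
    exact (Lp.fourierTransformₗᵢ (E N) ℂ).map_add _ _
  filter_upwards [Lp.coeFn_add (fourierL2 u) (fourierL2 v)] with ξ hξ
  simp only [symbolMul, h, Pi.add_apply]
  rw [hξ, Pi.add_apply, mul_add]

lemma symbolMul_smul {N : ℕ} (s c : ℝ) (u : L2 N) :
    symbolMul s (c • u) =ᵐ[volume] c • symbolMul s u := by
  have h : fourierL2 (c • u) = (c : ℂ) • fourierL2 u := by
    have h1 : Complex.ofRealCLM.compLpL 2 (volume : Measure (E N)) (c • u)
        = (c : ℂ) • Complex.ofRealCLM.compLpL 2 (volume : Measure (E N)) u := by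
      rw [map_smul]; rfl
    rw [fourierL2, h1]
    exact (Lp.fourierTransformₗᵢ (E N) ℂ).map_smul _ _
  filter_upwards [Lp.coeFn_smul (c : ℂ) (fourierL2 u)] with ξ hξ
  simp only [symbolMul, h, Pi.smul_apply, Complex.real_smul]
  rw [hξ, Pi.smul_apply, smul_eq_mul]
  ring

/-- The fractional Sobolev space
`H^s(ℝ^N) = {u ∈ L²(ℝ^N) | |·|^s û ∈ L²(ℝ^N)}` of real functions
(the constant factor `(2π)^s` in `symbolMul` is irrelevant for membership). -/
def Hs (N : ℕ) (s : ℝ) : Submodule ℝ (L2 N) where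
  carrier := {u | MemLp (symbolMul s u) 2 (volume : Measure (E N))}
  zero_mem' := (memLp_congr_ae (symbolMul_zero s)).2 MemLp.zero
  add_mem' {u v} hu hv :=
    (memLp_congr_ae (symbolMul_add s u v)).2 (MemLp.add (f := symbolMul s u) hu hv)
  smul_mem' c u hu :=
    (memLp_congr_ae (symbolMul_smul s c u)).2 (MemLp.const_smul (f := symbolMul s u) hu c)

variable {N : ℕ} {s : ℝ}

/-- `(-Δ)^{s/2} u = 𝓕⁻¹(|2πξ|^s û) ∈ L²(ℝ^N)` for `u ∈ H^s(ℝ^N)`. It is real-valued almost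
everywhere, since `u` is real, but it is stored as a complex `L²` class. -/
def halfLap (u : Hs N s) : Lp ℂ 2 (volume : Measure (E N)) :=
  𝓕⁻ (MemLp.toLp (symbolMul s u.1) u.2)

/-- `∫ (-Δ)^{s/2} u (-Δ)^{s/2} v dx`. -/
def form (u v : Hs N s) : ℝ :=
  ∫ x, (halfLap u x * (starRingEnd ℂ) (halfLap v x)).re

/-- `∫ |(-Δ)^{s/2} u|² dx`. -/
def kinetic (u : Hs N s) : ℝ := ∫ x, ‖halfLap u x‖ ^ 2

/-- `∫ u² dx`. -/
def mass (u : Hs N s) : ℝ := ∫ x, (u.1 x) ^ 2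

/-- The integral with values in `[-∞, +∞]` of a real function on `ℝ^N`: integral of the positive
part minus integral of the negative part. -/
def extIntegral (f : E N → ℝ) : EReal :=
  ((∫⁻ x, ENNReal.ofReal (f x) : ℝ≥0∞) : EReal) - ((∫⁻ x, ENNReal.ofReal (-f x) : ℝ≥0∞) : EReal)

/-- The fractional critical exponent `2*_s = 2N / (N - 2s)`. -/
def critExp (N : ℕ) (s : ℝ) : ℝ := 2 * N / (N - 2 * s)

/-- `G(t) = ∫_0^t g(τ) dτ`. -/
def primitive (g : ℝ → ℝ) (t : ℝ) : ℝ := ∫ τ in (0 : ℝ)..t, g τ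

/-- The energy `K(u) = ½ ∫ |(-Δ)^{s/2}u|² - ∫ G(u) ∈ ℝ ∪ {+∞}`. -/
def energy (g : ℝ → ℝ) (u : Hs N s) : EReal :=
  ((1 / 2 * kinetic u : ℝ) : EReal) - extIntegral (fun x => primitive g (u.1 x))

/-- The Lagrangian `I^m(μ,u) = ½ ∫ |(-Δ)^{s/2}u|² + (μ/2) (∫ u² - m) - ∫ G(u)`. -/
def lagrangian (g : ℝ → ℝ) (m μ : ℝ) (u : Hs N s) : EReal :=
  ((1 / 2 * kinetic u + μ / 2 * (mass u - m) : ℝ) : EReal)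
    - extIntegral (fun x => primitive g (u.1 x))

/-- The Pohozaev functional
`P(μ,u) = ∫ |(-Δ)^{s/2}u|² + 2*_s ∫ ((μ/2) u² - G(u))`. -/
def pohozaev (g : ℝ → ℝ) (μ : ℝ) (u : Hs N s) : EReal :=
  ((kinetic u : ℝ) : EReal)
    + ((critExp N s : ℝ) : EReal)
      * extIntegral (fun x => μ / 2 * (u.1 x) ^ 2 - primitive g (u.1 x))

/-- The Pohozaev identity
`(1/2*_s) ∫ |(-Δ)^{s/2}u|² + (μ/2) ∫ u² - ∫ G(u) = 0`; in particular `∫ G(u)` is finite. -/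
def PohozaevIdentity (g : ℝ → ℝ) (μ : ℝ) (u : Hs N s) : Prop :=
  ((1 / critExp N s * kinetic u + μ / 2 * mass u : ℝ) : EReal)
    - extIntegral (fun x => primitive g (u.1 x)) = 0

/-- The `L²`-sphere `S_m = {u ∈ H^s(ℝ^N) | |u|_2² = m}`. -/
def sphere (N : ℕ) (s m : ℝ) : Set (Hs N s) := {u | mass u = m}

/-- The Pohozaev set
`P_(ρ) = {(μ,u) ∈ (ρ,+∞) × H^s(ℝ^N) | u ≠ 0, P(μ,u) = 0}`, `ρ ∈ [-∞,+∞)`. -/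
def pohozaevSet (N : ℕ) (s : ℝ) (g : ℝ → ℝ) (ρ : EReal) : Set (ℝ × Hs N s) :=
  {p | ρ < (p.1 : EReal) ∧ p.2 ≠ 0 ∧ pohozaev g p.1 p.2 = 0}

/-- `u ∈ H^s(ℝ^N)` is a weak solution of `(-Δ)^s u + μ u = g(u)`: for every
`φ ∈ H^s(ℝ^N) ∩ L¹(ℝ^N)` the function `g(u) φ` is integrable and
`∫ (-Δ)^{s/2} u (-Δ)^{s/2} φ + μ ∫ u φ = ∫ g(u) φ`. -/
def IsWeakSolution (g : ℝ → ℝ) (μ : ℝ) (u : Hs N s) : Prop :=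
  ∀ φ : Hs N s, Integrable (fun x => φ.1 x) →
    Integrable (fun x => g (u.1 x) * φ.1 x) ∧
    form u φ + μ * ∫ x, u.1 x * φ.1 x = ∫ x, g (u.1 x) * φ.1 x

end FracNLS

end

/-! A dilation multiplies the mass and the integral of `G` by the same factor `c`, and the kinetic
term by `c ^ (2 / critExp N s)`. Every nonzero `v` can therefore be dilated onto the sphere, so
minimality of `u` becomes an explicit inequality against every `v ≠ 0` with `G(v)` integrable
(`energy_le_rescaled`). This inequality is used twice.

For `v = u + τ φ` it says that a function of `τ` has a minimum at `0`. Its vanishing derivative is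
the weak equation, with the explicit multiplier `μ = (2/m) (∫ G(u) - kinetic u / critExp N s)`
(`euler_lagrange_of_minimizer`). With this `μ` the Pohozaev identity is plain algebra, and no
regularity of `u` is needed.

For `v` in the Pohozaev set, the constraint eliminates `∫ G(v)`, and Bernoulli's inequality for the
exponent `2 / critExp N s ≤ 1` turns it into `K(u) ≤ I^m(l, v)` (`energy_le_lagrangian`). Equality
is attained at `(μ, u)`, which is admissible since `μ ≥ -(2/m) K(u) > ρ`.

The analytic input is the Sobolev embedding `integrable_abs_rpow_critExp`, proved by frequency
splitting. It makes the positive part of `G(u)` integrable; a finite-energy competitor then makes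
`G(u)` itself integrable. -/

namespace FracNLS

variable {N : ℕ} {s : ℝ}

/-! ### The `L²` Fourier transform: duality with Schwartz functions, dilations, `L¹` bound. -/

open SchwartzMap in
lemma integral_smul_fourier (f : Lp ℂ 2 (volume : Measure (E N))) (ψ : 𝓢(E N, ℂ)) :
    ∫ x, ψ x • (𝓕 f : Lp ℂ 2 (volume : Measure (E N))) x = ∫ x, (𝓕 ψ) x • f x := by
  have h := congrArg (fun T : 𝓢'(E N, ℂ) => T ψ) (Lp.fourier_toTemperedDistribution_eq f)
  simpa [TemperedDistribution.fourier_apply] using h.symm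

open SchwartzMap in
lemma integral_smul_fourierInv (f : Lp ℂ 2 (volume : Measure (E N))) (ψ : 𝓢(E N, ℂ)) :
    ∫ x, ψ x • (𝓕⁻ f : Lp ℂ 2 (volume : Measure (E N))) x = ∫ x, (𝓕⁻ ψ) x • f x := by
  have h := congrArg (fun T : 𝓢'(E N, ℂ) => T ψ) (Lp.fourierInv_toTemperedDistribution_eq f)
  simpa [TemperedDistribution.fourierInv_apply] using h.symm

-- Smooth compactly supported functions are Schwartz, so they suffice as tests. This lets identities
-- for the `L²` transform, which is not given by an integral, be checked by duality.
open SchwartzMap in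
lemma ae_eq_of_integral_schwartz_smul_eq {f h : E N → ℂ}
    (hf : LocallyIntegrable f) (hh : LocallyIntegrable h)
    (H : ∀ ψ : 𝓢(E N, ℂ), ∫ x, ψ x • f x = ∫ x, ψ x • h x) : f =ᵐ[volume] h := by
  refine ae_eq_of_integral_contDiff_smul_eq hf hh fun g hg hc => ?_
  have hc' : HasCompactSupport (fun x => (g x : ℂ)) := hc.comp_left (g := ((↑) : ℝ → ℂ)) rfl
  have hg' : ContDiff ℝ (↑(⊤ : ℕ∞)) (fun x => (g x : ℂ)) := Complex.ofRealCLM.contDiff.comp hg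
  simpa using H (hc'.toSchwartzMap hg')

lemma memLp_comp_smul {F : Type*} [NormedAddCommGroup F] {f : E N → F} {p : ℝ≥0∞}
    (hf : MemLp f p) {t : ℝ} (ht : 0 < t) : MemLp (fun x => f (t • x)) p := by
  have hmap : Measure.map (fun x : E N => t • x) volume
      = ENNReal.ofReal |(t ^ Module.finrank ℝ (E N))⁻¹| • (volume : Measure (E N)) :=
    Measure.map_addHaar_smul volume ht.ne'
  have h2 : MemLp f p (Measure.map (fun x : E N => t • x) volume) := by
    rw [hmap]; exact hf.smul_measure ENNReal.ofReal_ne_top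
  exact h2.comp_of_map (measurable_const_smul t).aemeasurable

lemma ae_comp_smul {p : E N → Prop} (hp : ∀ᵐ x, p x) {t : ℝ} (ht : t ≠ 0) :
    ∀ᵐ x : E N, p (t • x) := by
  have hq : Measure.QuasiMeasurePreserving (fun x : E N => t • x) volume volume := by
    refine ⟨measurable_const_smul t, ?_⟩
    rw [Measure.map_addHaar_smul volume ht]
    exact Measure.smul_absolutelyContinuous
  exact hq.ae hp

lemma fourier_comp_smul (ψ : E N → ℂ) {t : ℝ} (ht : 0 < t) (ξ : E N) :
    𝓕 (fun x => ψ (t • x)) ξ = ((t ^ N)⁻¹ : ℝ) • 𝓕 ψ (t⁻¹ • ξ) := by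
  rw [Real.fourier_eq, Real.fourier_eq]
  have := Measure.integral_comp_smul_of_nonneg (volume : Measure (E N))
    (fun v => Real.fourierChar (-inner ℝ v (t⁻¹ • ξ)) • ψ v) t (hR := ht.le)
  rw [finrank_euclideanSpace_fin] at this
  rw [← this]
  congr 1; ext v
  rw [inner_smul_left, inner_smul_right]
  simp [ht.ne']

open SchwartzMap in
/-- The `L²` Fourier transform intertwines dilations. -/
lemma fourier_dilation {f h : Lp ℂ 2 (volume : Measure (E N))} {t : ℝ} (ht : 0 < t)
    (hh : h =ᵐ[volume] fun x => f (t • x)) :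
    (𝓕 h : Lp ℂ 2 (volume : Measure (E N))) =ᵐ[volume]
      fun ξ => ((t ^ N)⁻¹ : ℝ) • (𝓕 f : Lp ℂ 2 (volume : Measure (E N))) (t⁻¹ • ξ) := by
  have htN : 0 < t ^ N := by positivity
  refine ae_eq_of_integral_schwartz_smul_eq ((Lp.memLp _).locallyIntegrable (by norm_num))
    (((memLp_comp_smul (Lp.memLp (𝓕 f)) (inv_pos.2 ht)).const_smul ((t ^ N)⁻¹ : ℝ)).locallyIntegrable
      (by norm_num)) fun ψ => ?_
  rw [integral_smul_fourier]
  have hL : ∫ x, (𝓕 ψ) x • h x = ∫ x, (𝓕 ψ) x • f (t • x) := by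
    refine integral_congr_ae ?_
    filter_upwards [hh] with x hx
    rw [hx]
  -- The change of variables moves the dilation from `f` to `𝓕 ψ`, that is, to the dilated test
  -- function `ψ'`, whose transform is a classical integral.
  let e : E N ≃L[ℝ] E N := ContinuousLinearEquiv.smulLeft (Units.mk0 t ht.ne')
  let ψ' : 𝓢(E N, ℂ) := compCLMOfContinuousLinearEquiv ℂ e ψ
  have hψ' : ∀ x, ψ' x = ψ (t • x) := fun x => rfl
  have hF : ∀ x, (𝓕 ψ') x = ((t ^ N)⁻¹ : ℝ) • (𝓕 ψ) (t⁻¹ • x) := by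
    intro x
    rw [fourier_coe, fourier_coe, ← fourier_comp_smul _ ht]
    rfl
  have h1 := Measure.integral_comp_smul_of_nonneg (volume : Measure (E N))
    (fun x => (𝓕 ψ) (t⁻¹ • x) • f x) t (hR := ht.le)
  have h2 := Measure.integral_comp_smul_of_nonneg (volume : Measure (E N))
    (fun ξ => ψ ξ • ((t ^ N)⁻¹ : ℝ) • (𝓕 f : Lp ℂ 2 (volume : Measure (E N))) (t⁻¹ • ξ)) t
    (hR := ht.le)
  rw [finrank_euclideanSpace_fin] at h1 h2
  simp only [smul_smul, inv_mul_cancel₀ ht.ne', one_smul] at h1 h2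
  have h3 := integral_smul_fourier f ψ'
  simp only [hF, hψ', smul_assoc] at h3
  rw [hL, h1, ← integral_smul, ← h3]
  have h4 : ∀ x, ψ (t • x) • ((t ^ N)⁻¹ : ℝ) • (𝓕 f : Lp ℂ 2 (volume : Measure (E N))) x
      = ((t ^ N)⁻¹ : ℝ) • (ψ (t • x) • (𝓕 f : Lp ℂ 2 (volume : Measure (E N))) x) :=
    fun x => smul_comm _ _ _
  simp only [h4] at h2
  rw [integral_smul] at h2
  exact smul_right_injective _ (inv_ne_zero htN.ne') h2

/-- On `L¹ ∩ L²` the inverse `L²` Fourier transform is bounded by the `L¹` norm. -/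
lemma norm_fourierInv_le (f : Lp ℂ 2 (volume : Measure (E N))) (hf : Integrable f) :
    ∀ᵐ x, ‖(𝓕⁻ f : Lp ℂ 2 (volume : Measure (E N))) x‖ ≤ ∫ ξ, ‖f ξ‖ := by
  have hbd : ∀ x, ‖𝓕⁻ (f : E N → ℂ) x‖ ≤ ∫ ξ, ‖f ξ‖ := fun x => by
    rw [Real.fourierInv_eq]
    refine (norm_integral_le_integral_norm _).trans_eq ?_
    simp
  have hcont : Continuous (𝓕⁻ (f : E N → ℂ)) := by
    have := VectorFourier.fourierIntegral_continuous Real.continuous_fourierChar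
      (L := -innerₗ (E N)) (by simp only [LinearMap.neg_apply, innerₗ_apply_apply]; fun_prop) hf
    convert this using 1
    ext x
    simp [Real.fourierInv_eq, VectorFourier.fourierIntegral]
  have : (𝓕⁻ f : Lp ℂ 2 (volume : Measure (E N))) =ᵐ[volume] 𝓕⁻ (f : E N → ℂ) := by
    refine ae_eq_of_integral_schwartz_smul_eq ((Lp.memLp _).locallyIntegrable (by norm_num))
      hcont.locallyIntegrable fun ψ => ?_
    rw [integral_smul_fourierInv]
    have h := VectorFourier.integral_fourierIntegral_smul_eq_flip (L := -innerₗ (E N))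
      Real.continuous_fourierChar (by simp only [LinearMap.neg_apply, innerₗ_apply_apply]; fun_prop) (ψ.integrable (μ := volume)) hf
    rw [SchwartzMap.fourierInv_coe]
    have e1 : ∀ x, VectorFourier.fourierIntegral Real.fourierChar volume (-innerₗ (E N)) ψ x
        = 𝓕⁻ (ψ : E N → ℂ) x := fun x => by
      simp [Real.fourierInv_eq, VectorFourier.fourierIntegral]
    have e2 : ∀ x, VectorFourier.fourierIntegral Real.fourierChar volume (-innerₗ (E N)).flip f x
        = 𝓕⁻ (f : E N → ℂ) x := fun x => by
      simp [Real.fourierInv_eq, VectorFourier.fourierIntegral, real_inner_comm]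
    simpa only [e1, e2] using h
  filter_upwards [this] with x hx
  rw [hx]
  exact hbd x

/-! ### Kinetic term and mass as quadratic forms. -/

lemma halfLap_add (u v : Hs N s) : halfLap (u + v) = halfLap u + halfLap v := by
  have h : MemLp.toLp (symbolMul s (u + v).1) (u + v).2
      = MemLp.toLp (symbolMul s u.1) u.2 + MemLp.toLp (symbolMul s v.1) v.2 := by
    refine Eq.trans ?_ (MemLp.toLp_add (show MemLp (symbolMul s u.1) 2 volume from u.2)
      (show MemLp (symbolMul s v.1) 2 volume from v.2))
    exact MemLp.toLp_congr _ _ (symbolMul_add s u.1 v.1)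
  rw [halfLap, h]
  exact (Lp.fourierTransformₗᵢ (E N) ℂ).symm.map_add _ _

lemma halfLap_smul (c : ℝ) (u : Hs N s) : halfLap (c • u) = (c : ℂ) • halfLap u := by
  have h : MemLp.toLp (symbolMul s (c • u).1) (c • u).2
      = (c : ℂ) • MemLp.toLp (symbolMul s u.1) u.2 := by
    refine Eq.trans ?_ (MemLp.toLp_const_smul (c : ℂ)
      (show MemLp (symbolMul s u.1) 2 volume from u.2))
    refine MemLp.toLp_congr _ _ ((symbolMul_smul s c u.1).trans (ae_of_all _ fun x => ?_))
    simp
  rw [halfLap, h]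
  exact (Lp.fourierTransformₗᵢ (E N) ℂ).symm.map_smul _ _

lemma kinetic_eq_norm_sq (u : Hs N s) : kinetic u = ‖halfLap u‖ ^ 2 := by
  have h := congrArg RCLike.re (L2.inner_def (𝕜 := ℂ) (halfLap u) (halfLap u))
  rw [inner_self_eq_norm_sq] at h
  rw [h, ← integral_re (L2.integrable_inner _ _)]
  simp only [inner_self_eq_norm_sq]
  rfl

lemma form_eq_re_inner (u v : Hs N s) :
    form u v = (inner ℂ (halfLap v) (halfLap u)).re := by
  rw [L2.inner_def]
  have := integral_re (L2.integrable_inner (𝕜 := ℂ) (halfLap v) (halfLap u))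
  exact this

lemma kinetic_nonneg (u : Hs N s) : 0 ≤ kinetic u := by
  rw [kinetic_eq_norm_sq]; positivity

lemma kinetic_add_smul (u φ : Hs N s) (τ : ℝ) :
    kinetic (u + τ • φ) = kinetic u + 2 * τ * form u φ + τ ^ 2 * kinetic φ := by
  have h1 := norm_add_sq (𝕜 := ℂ) (halfLap u) ((τ : ℂ) • halfLap φ)
  have h2 : (inner ℂ (halfLap u) (halfLap φ)).re = form u φ := by
    rw [form_eq_re_inner]; exact inner_re_symm (𝕜 := ℂ) _ _
  rw [kinetic_eq_norm_sq, halfLap_add, halfLap_smul, h1, inner_smul_right, norm_smul,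
    ← kinetic_eq_norm_sq, mul_pow, ← kinetic_eq_norm_sq, ← h2]
  simp
  ring

lemma coeFn_add_smul (u φ : Hs N s) (τ : ℝ) :
    (u + τ • φ).1 =ᵐ[volume] fun x => u.1 x + τ * φ.1 x := by
  filter_upwards [Lp.coeFn_add u.1 (τ • φ.1), Lp.coeFn_smul τ φ.1] with x h1 h2
  change (u.1 + τ • φ.1 : L2 N) x = _
  rw [h1, Pi.add_apply, h2]; rfl

lemma integrable_sq (u : Hs N s) : Integrable fun x => (u.1 x) ^ 2 := (Lp.memLp u.1).integrable_sq

lemma integrable_mul (u φ : Hs N s) : Integrable fun x => u.1 x * φ.1 x :=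
  (Lp.memLp u.1).integrable_mul (Lp.memLp φ.1)

lemma mass_add_smul (u φ : Hs N s) (τ : ℝ) :
    mass (u + τ • φ) = mass u + 2 * τ * (∫ x, u.1 x * φ.1 x) + τ ^ 2 * mass φ := by
  have h1 : Integrable fun x => (u.1 x) ^ 2 + 2 * τ * (u.1 x * φ.1 x) :=
    (integrable_sq u).add ((integrable_mul u φ).const_mul _)
  rw [mass, mass, mass, ← integral_const_mul, ← integral_const_mul,
    ← integral_add (integrable_sq u) ((integrable_mul u φ).const_mul _), ← integral_add
      h1 ((integrable_sq φ).const_mul _)]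
  refine integral_congr_ae ?_
  filter_upwards [coeFn_add_smul u φ τ] with x hx
  rw [hx]; ring

lemma mass_zero : mass (0 : Hs N s) = 0 := by
  have h : mass (0 : Hs N s) = ∫ _x : E N, (0 : ℝ) := by
    refine integral_congr_ae ?_
    filter_upwards [Lp.coeFn_zero ℝ 2 (volume : Measure (E N))] with x hx
    change ((0 : L2 N) x) ^ 2 = 0
    rw [hx]; simp
  simpa using h

lemma mass_pos {u : Hs N s} (hu : u ≠ 0) : 0 < mass u := by
  have h0 : 0 ≤ mass u := integral_nonneg fun x => sq_nonneg _
  refine h0.lt_of_ne fun h => hu ?_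
  have h1 := (integral_eq_zero_iff_of_nonneg (fun x => sq_nonneg (u.1 x)) (integrable_sq u)).1 h.symm
  apply Subtype.ext
  apply Lp.ext
  filter_upwards [h1, Lp.coeFn_zero ℝ 2 (volume : Measure (E N))] with x hx hx0
  change u.1 x = (0 : L2 N) x
  rw [hx0]
  simpa using hx

/-! ### Plancherel for the kinetic term, and dilations in `H^s`. -/

lemma kinetic_eq_integral_symbolMul (u : Hs N s) :
    kinetic u = ∫ ξ, ‖symbolMul s u.1 ξ‖ ^ 2 := by
  have h1 : ‖halfLap u‖ = ‖MemLp.toLp (symbolMul s u.1) u.2‖ :=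
    (Lp.fourierTransformₗᵢ (E N) ℂ).symm.norm_map _
  have h := congrArg RCLike.re (L2.inner_def (𝕜 := ℂ) (MemLp.toLp (symbolMul s u.1) u.2)
    (MemLp.toLp (symbolMul s u.1) u.2))
  rw [inner_self_eq_norm_sq] at h
  rw [kinetic_eq_norm_sq, h1, h, ← integral_re (L2.integrable_inner _ _)]
  simp only [inner_self_eq_norm_sq]
  refine integral_congr_ae ?_
  filter_upwards [MemLp.coeFn_toLp u.2] with x hx
  rw [hx]

lemma coeFn_compLpL_ofReal (u : L2 N) :
    Complex.ofRealCLM.compLpL 2 (volume : Measure (E N)) u =ᵐ[volume] fun x => (u x : ℂ) := by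
  filter_upwards [ContinuousLinearMap.coeFn_compLpL Complex.ofRealCLM u] with x hx
  rw [hx]; rfl

/-- Every `u ∈ H^s(ℝ^N)` can be dilated: the result is `x ↦ u (t x)`. -/
lemma exists_dilation (u : Hs N s) {t : ℝ} (ht : 0 < t) :
    ∃ v : Hs N s, (v.1 =ᵐ[volume] fun x => u.1 (t • x)) ∧
      kinetic v = (t ^ N)⁻¹ * t ^ (2 * s) * kinetic u := by
  let w : L2 N := (memLp_comp_smul (Lp.memLp u.1) ht).toLp
  have hw : w =ᵐ[volume] fun x => u.1 (t • x) := MemLp.coeFn_toLp _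
  have hF : fourierL2 w =ᵐ[volume] fun ξ => ((t ^ N)⁻¹ : ℝ) • fourierL2 u.1 (t⁻¹ • ξ) := by
    refine fourier_dilation ht ?_
    filter_upwards [coeFn_compLpL_ofReal w, hw, ae_comp_smul (coeFn_compLpL_ofReal u.1) ht.ne']
      with x h1 h2 h3
    rw [h1, h2, h3]
  have hS : symbolMul s w =ᵐ[volume]
      fun ξ => ((t ^ N)⁻¹ * t ^ s : ℝ) • symbolMul s u.1 (t⁻¹ • ξ) := by
    filter_upwards [hF] with ξ hξ
    have e : (2 * Real.pi * ‖ξ‖) ^ s = t ^ s * (2 * Real.pi * ‖t⁻¹ • ξ‖) ^ s := by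
      rw [← Real.mul_rpow ht.le (by positivity), norm_smul, Real.norm_of_nonneg (by positivity)]
      congr 1
      field_simp
    simp only [symbolMul, hξ, e, Complex.real_smul]
    push_cast
    ring
  have hM : MemLp (symbolMul s w) 2 volume :=
    (memLp_congr_ae hS).2 ((memLp_comp_smul u.2 (inv_pos.2 ht)).const_smul ((t ^ N)⁻¹ * t ^ s : ℝ))
  refine ⟨⟨w, hM⟩, hw, ?_⟩
  rw [kinetic_eq_integral_symbolMul, kinetic_eq_integral_symbolMul]
  have h1 : ∫ ξ, ‖symbolMul s w ξ‖ ^ 2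
      = ∫ ξ, ((t ^ N)⁻¹ * t ^ s) ^ 2 * ‖symbolMul s u.1 (t⁻¹ • ξ)‖ ^ 2 := by
    refine integral_congr_ae ?_
    filter_upwards [hS] with ξ hξ
    rw [hξ, norm_smul, mul_pow, Real.norm_of_nonneg (by positivity)]
  have h2 := Measure.integral_comp_inv_smul_of_nonneg (volume : Measure (E N))
    (fun ξ => ‖symbolMul s u.1 ξ‖ ^ 2) ht.le
  rw [finrank_euclideanSpace_fin] at h2
  rw [h1, integral_const_mul, h2, mul_comm 2 s, Real.rpow_mul ht.le, Real.rpow_two, smul_eq_mul]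
  have : t ^ N ≠ 0 := by positivity
  field_simp

/-! ### Extended-valued integrals. -/

lemma extIntegral_of_integrable {f : E N → ℝ} (hf : Integrable f) :
    extIntegral f = ((∫ x, f x : ℝ) : EReal) := by
  rw [integral_eq_lintegral_pos_part_sub_lintegral_neg_part hf, extIntegral]
  have h1 : ∫⁻ x, ENNReal.ofReal (f x) ≠ ⊤ :=
    ((lintegral_ofReal_le_lintegral_enorm f).trans_lt hf.2).ne
  have h2 : ∫⁻ x, ENNReal.ofReal (-f x) ≠ ⊤ :=
    ((lintegral_ofReal_le_lintegral_enorm fun x => -f x).trans_lt hf.neg.2).ne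
  rw [EReal.coe_sub, EReal.coe_ennreal_toReal h1, EReal.coe_ennreal_toReal h2]

lemma integrable_of_extIntegral {f : E N → ℝ} (hf : AEStronglyMeasurable f)
    (h1 : ∫⁻ x, ENNReal.ofReal (f x) ≠ ⊤) (h2 : ∫⁻ x, ENNReal.ofReal (-f x) ≠ ⊤) :
    Integrable f := by
  refine ⟨hf, ?_⟩
  have : ∀ x, ‖f x‖ₑ = ENNReal.ofReal (f x) + ENNReal.ofReal (-f x) := fun x => by
    rw [Real.enorm_eq_ofReal_abs]
    rcases le_total 0 (f x) with h | h
    · rw [abs_of_nonneg h, ENNReal.ofReal_of_nonpos (neg_nonpos.2 h), add_zero]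
    · rw [abs_of_nonpos h, ENNReal.ofReal_of_nonpos h, zero_add]
  rw [HasFiniteIntegral]
  simp only [this]
  rw [lintegral_add_left' hf.aemeasurable.ennreal_ofReal]
  exact ENNReal.add_lt_top.2 ⟨h1.lt_top, h2.lt_top⟩

lemma integrable_of_extIntegral_eq_coe {f : E N → ℝ} (hf : AEStronglyMeasurable f) {c : ℝ}
    (h : extIntegral f = c) : Integrable f := by
  unfold extIntegral at h
  refine integrable_of_extIntegral hf (fun h1 => ?_) (fun h2 => ?_)
  · rw [h1] at h
    -- In `EReal`, `⊤ - ⊤ = ⊥`, so even the indeterminate case is not a real value.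
    rcases eq_or_ne (∫⁻ x, ENNReal.ofReal (-f x)) ⊤ with h2 | h2
    · rw [h2] at h
      simp at h
    · rw [← ENNReal.ofReal_toReal h2] at h
      simp at h
  · rw [h2] at h
    simp at h

/-! ### Sobolev embedding by frequency splitting. -/

lemma lintegral_enorm_sq_eq (f : Lp ℂ 2 (volume : Measure (E N))) :
    ∫⁻ x, ‖f x‖ₑ ^ 2 = ‖f‖ₑ ^ 2 := by
  have h := eLpNorm_nnreal_pow_eq_lintegral (f := (f : E N → ℂ)) (μ := volume) (p := 2) two_ne_zero
  rw [Lp.enorm_def]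
  simpa using h.symm

lemma lintegral_enorm_sq_fourierInv (f : Lp ℂ 2 (volume : Measure (E N))) :
    ∫⁻ x, ‖(𝓕⁻ f : Lp ℂ 2 (volume : Measure (E N))) x‖ₑ ^ 2 = ∫⁻ x, ‖f x‖ₑ ^ 2 := by
  have h : ‖(𝓕⁻ f : Lp ℂ 2 (volume : Measure (E N)))‖ = ‖f‖ :=
    (Lp.fourierTransformₗᵢ (E N) ℂ).symm.norm_map f
  rw [lintegral_enorm_sq_eq, lintegral_enorm_sq_eq, ← ofReal_norm, ← ofReal_norm, h]

open Metric in
lemma setIntegral_ball_rpow (R : ℝ) (hR : 0 < R) :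
    ∫ ξ in ball (0 : E N) R, (2 * Real.pi * ‖ξ‖) ^ (-(2 * s))
      = R ^ (N - 2 * s) * ∫ ξ in ball (0 : E N) 1, (2 * Real.pi * ‖ξ‖) ^ (-(2 * s)) := by
  have h := Measure.integral_comp_inv_smul_of_nonneg (volume : Measure (E N))
    ((ball (0 : E N) 1).indicator fun ξ => (2 * Real.pi * ‖ξ‖) ^ (-(2 * s))) hR.le
  rw [finrank_euclideanSpace_fin, integral_indicator measurableSet_ball] at h
  rw [Real.rpow_sub hR, Real.rpow_natCast, div_mul_eq_mul_div, ← smul_eq_mul (R ^ N), ← h,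
    div_eq_inv_mul, ← Real.rpow_neg hR.le, ← integral_const_mul,
    ← integral_indicator measurableSet_ball]
  congr 1; ext ξ
  have hmem : R⁻¹ • ξ ∈ ball (0 : E N) 1 ↔ ξ ∈ ball (0 : E N) R := by
    rw [mem_ball_zero_iff, mem_ball_zero_iff, norm_smul, Real.norm_of_nonneg (inv_pos.2 hR).le,
      inv_mul_lt_iff₀ hR, mul_one]
  by_cases hξ : ξ ∈ ball (0 : E N) R
  · rw [Set.indicator_of_mem hξ, Set.indicator_of_mem (hmem.2 hξ),
      ← Real.mul_rpow hR.le (by positivity), norm_smul, Real.norm_of_nonneg (inv_pos.2 hR).le]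
    congr 1
    field_simp
  · rw [Set.indicator_of_notMem hξ, Set.indicator_of_notMem (fun h => hξ (hmem.1 h)), mul_zero]

lemma norm_symbolMul (u : L2 N) (ξ : E N) :
    ‖symbolMul s u ξ‖ = (2 * Real.pi * ‖ξ‖) ^ s * ‖fourierL2 u ξ‖ := by
  rw [symbolMul, norm_mul, Complex.norm_real, Real.norm_of_nonneg (by positivity)]

-- Cauchy–Schwarz in Young form: `|2πξ|^{-s}` is square integrable on the ball because `2s < N`, and
-- `|2πξ|^s û` is square integrable because `u ∈ H^s`. The constant may depend on `u`, since only
-- finiteness of the critical integral is wanted.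
open Metric in
lemma exists_lowFreq_bound (hs : 0 < s) (hN : 2 * s < N) (u : Hs N s) :
    ∃ D : ℝ, 0 < D ∧ ∀ R : ℝ, 0 < R → IntegrableOn (fourierL2 u.1) (ball 0 R) ∧
      ∫ ξ in ball 0 R, ‖fourierL2 u.1 ξ‖ ≤ D * R ^ (N / 2 - s) := by
  have hN0 : 0 < N := by
    have : (0 : ℝ) < N := by linarith
    exact_mod_cast this
  have : Nonempty (Fin N) := ⟨⟨0, hN0⟩⟩
  set c := ∫ ξ in ball (0 : E N) 1, (2 * Real.pi * ‖ξ‖) ^ (-(2 * s))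
  have hc : 0 ≤ c := integral_nonneg fun ξ => by positivity
  refine ⟨(c + kinetic u) / 2 + 1, by have := kinetic_nonneg u; positivity, fun R hR => ?_⟩
  have : IsFiniteMeasure ((volume : Measure (E N)).restrict (ball 0 R)) :=
    isFiniteMeasure_restrict.2 measure_ball_lt_top.ne
  have hI : IntegrableOn (fourierL2 u.1) (ball 0 R) :=
    ((Lp.memLp (fourierL2 u.1)).restrict _).integrable one_le_two
  refine ⟨hI, ?_⟩
  set a : ℝ := N / 2 - s
  have h1 : IntegrableOn (fun ξ : E N => (2 * Real.pi * ‖ξ‖) ^ (-(2 * s))) (ball 0 R) := by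
    refine integrableOn_ball_of_norm_le_rpow (C := (2 * Real.pi) ^ (-(2 * s))) (α := 2 * s)
      (μ := volume) ?_ ?_ ?_ ?_
    · rw [finrank_euclideanSpace_fin]; omega
    · rw [finrank_euclideanSpace_fin]; exact hN
    · refine ae_of_all _ fun ξ => ?_
      rw [Real.norm_of_nonneg (by positivity), Real.mul_rpow (by positivity) (by positivity)]
    · exact (Measurable.pow_const (by fun_prop) _).aestronglyMeasurable
  have h2 : Integrable fun ξ => ‖symbolMul s u.1 ξ‖ ^ 2 :=
    (show MemLp (symbolMul s u.1) 2 volume from u.2).integrable_norm_pow two_ne_zero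
  -- AM-GM with weight `R ^ a`, chosen so that after integration both terms scale like `R ^ a`. The
  -- origin is discarded because the negative power takes the default value `0` there.
  have hpt : ∀ᵐ ξ : E N, ‖fourierL2 u.1 ξ‖ ≤
      R ^ (-a) / 2 * (2 * Real.pi * ‖ξ‖) ^ (-(2 * s)) + R ^ a / 2 * ‖symbolMul s u.1 ξ‖ ^ 2 := by
    filter_upwards [Measure.ae_ne volume (0 : E N)] with ξ hξ
    have hp : 0 < 2 * Real.pi * ‖ξ‖ := by have := norm_pos_iff.2 hξ; positivity
    rw [norm_symbolMul, Real.rpow_neg hp.le, Real.rpow_neg hR.le, mul_comm 2 s,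
      Real.rpow_mul hp.le, Real.rpow_two]
    have hA : 0 < R ^ a := by positivity
    have hB : 0 < (2 * Real.pi * ‖ξ‖) ^ s := by positivity
    set A := R ^ a
    set B := (2 * Real.pi * ‖ξ‖) ^ s
    set y := ‖fourierL2 u.1 ξ‖
    have : A⁻¹ / 2 * (B ^ 2)⁻¹ + A / 2 * (B * y) ^ 2 - y
        = (A * B ^ 2 * y - 1) ^ 2 / (2 * A * B ^ 2) := by field_simp; ring
    have h0 : 0 ≤ (A * B ^ 2 * y - 1) ^ 2 / (2 * A * B ^ 2) := by positivity
    linarith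
  have hle : ∫ ξ in ball (0 : E N) R, ‖symbolMul s u.1 ξ‖ ^ 2 ≤ kinetic u := by
    rw [kinetic_eq_integral_symbolMul]
    exact setIntegral_le_integral h2 (ae_of_all _ fun ξ => by positivity)
  calc ∫ ξ in ball 0 R, ‖fourierL2 u.1 ξ‖
      ≤ ∫ ξ in ball (0 : E N) R, (R ^ (-a) / 2 * (2 * Real.pi * ‖ξ‖) ^ (-(2 * s))
          + R ^ a / 2 * ‖symbolMul s u.1 ξ‖ ^ 2) :=
        integral_mono_ae hI.norm ((h1.const_mul _).add (h2.integrableOn.const_mul _))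
          (ae_restrict_of_ae hpt)
    _ = R ^ (-a) / 2 * (R ^ (N - 2 * s) * c)
          + R ^ a / 2 * ∫ ξ in ball (0 : E N) R, ‖symbolMul s u.1 ξ‖ ^ 2 := by
        rw [integral_add (h1.const_mul _) (h2.integrableOn.const_mul _), integral_const_mul,
          integral_const_mul, setIntegral_ball_rpow R hR]
    _ ≤ R ^ a / 2 * c + R ^ a / 2 * kinetic u := by
        have e : R ^ (-a) * R ^ (N - 2 * s) = R ^ a := by
          rw [← Real.rpow_add hR]; congr 1; simp only [a]; ring
        have hA : 0 < R ^ a := by positivity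
        have := mul_le_mul_of_nonneg_left hle (by positivity : 0 ≤ R ^ a / 2)
        rw [div_mul_eq_mul_div, ← mul_assoc, e]
        linarith
    _ ≤ ((c + kinetic u) / 2 + 1) * R ^ a := by
        have hA : 0 < R ^ a := by positivity
        nlinarith

-- Cut at the radius `R` with `D * R ^ a = l / 2`. The low-frequency part is then at most `l / 2`
-- almost everywhere, so `|u| > l` forces the high-frequency part above `l / 2`; Chebyshev and
-- Plancherel finish.
open Metric in
lemma meas_lt_abs_le (u : Hs N s) {D : ℝ} (hD : 0 < D) (ha : 0 < N / 2 - s)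
    (hlow : ∀ R : ℝ, 0 < R → IntegrableOn (fourierL2 u.1) (ball 0 R) ∧
      ∫ ξ in ball 0 R, ‖fourierL2 u.1 ξ‖ ≤ D * R ^ (N / 2 - s)) {l : ℝ} (hl : 0 < l) :
    volume {x | l < |u.1 x|} ≤ ENNReal.ofReal (4 / l ^ 2) *
      ∫⁻ ξ in {ξ : E N | l ≤ 2 * D * ‖ξ‖ ^ (N / 2 - s)}, ‖fourierL2 u.1 ξ‖ₑ ^ 2 := by
  set a : ℝ := N / 2 - s
  set U := fourierL2 u.1 with hU
  set R : ℝ := (l / (2 * D)) ^ a⁻¹ with hR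
  have hR0 : 0 < R := by positivity
  have hRa : D * R ^ a = l / 2 := by
    rw [hR, Real.rpow_inv_rpow (by positivity) ha.ne']; field_simp
  have hset : (ball (0 : E N) R)ᶜ = {ξ : E N | l ≤ 2 * D * ‖ξ‖ ^ a} := by
    ext ξ
    simp only [Set.mem_compl_iff, mem_ball_zero_iff, not_lt, Set.mem_ofPred_eq]
    rw [hR, Real.rpow_inv_le_iff_of_pos (by positivity) (norm_nonneg _) ha,
      div_le_iff₀' (by positivity)]
  have hmL : MemLp ((ball (0 : E N) R).indicator U) 2 volume :=
    (Lp.memLp U).indicator measurableSet_ball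
  have hmH : MemLp ((ball (0 : E N) R)ᶜ.indicator U) 2 volume :=
    (Lp.memLp U).indicator measurableSet_ball.compl
  have hsum : U = hmL.toLp + hmH.toLp := by
    apply Lp.ext
    filter_upwards [hmL.coeFn_toLp, hmH.coeFn_toLp, Lp.coeFn_add hmL.toLp hmH.toLp]
      with ξ h1 h2 h3
    rw [h3, Pi.add_apply, h1, h2]
    exact (congrFun (Set.indicator_self_add_compl _ _) ξ).symm
  have hinv : Complex.ofRealCLM.compLpL 2 (volume : Measure (E N)) u.1
      = 𝓕⁻ hmL.toLp + 𝓕⁻ hmH.toLp := by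
    have h1 : Complex.ofRealCLM.compLpL 2 (volume : Measure (E N)) u.1 = 𝓕⁻ U :=
      ((Lp.fourierTransformₗᵢ (E N) ℂ).symm_apply_apply _).symm
    rw [h1]
    conv_lhs => rw [hsum]
    exact (Lp.fourierTransformₗᵢ (E N) ℂ).symm.map_add _ _
  have hLint : Integrable (hmL.toLp : E N → ℂ) :=
    ((integrable_indicator_iff measurableSet_ball).2 (hlow R hR0).1).congr hmL.coeFn_toLp.symm
  have hLb : ∫ ξ, ‖(hmL.toLp : E N → ℂ) ξ‖ ≤ l / 2 := by
    rw [← hRa]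
    refine le_trans (le_of_eq ?_) (hlow R hR0).2
    rw [← integral_indicator measurableSet_ball]
    refine integral_congr_ae ?_
    filter_upwards [hmL.coeFn_toLp] with ξ h
    rw [h, norm_indicator_eq_indicator_norm]
  set H : Lp ℂ 2 (volume : Measure (E N)) := 𝓕⁻ hmH.toLp
  have hsub : {x | l < |u.1 x|} ≤ᵐ[volume] {x | ENNReal.ofReal (l ^ 2 / 4) ≤ ‖H x‖ₑ ^ 2} := by
    filter_upwards [norm_fourierInv_le _ hLint, coeFn_compLpL_ofReal u.1,
      Lp.coeFn_add (𝓕⁻ hmL.toLp) H] with x h1 h2 h3 hx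
    change l < |u.1 x| at hx
    change ENNReal.ofReal (l ^ 2 / 4) ≤ ‖H x‖ₑ ^ 2
    rw [hinv, h3, Pi.add_apply] at h2
    have h4 : |u.1 x| ≤ l / 2 + ‖H x‖ := by
      rw [← Real.norm_eq_abs, ← Complex.norm_real, ← h2]
      exact (norm_add_le _ _).trans (by gcongr; exact h1.trans hLb)
    rw [← ofReal_norm, ← ENNReal.ofReal_pow (norm_nonneg _)]
    apply ENNReal.ofReal_le_ofReal
    nlinarith
  have hcheb := mul_meas_ge_le_lintegral₀ (μ := (volume : Measure (E N)))
    (f := fun x => ‖H x‖ₑ ^ 2) ((Lp.aestronglyMeasurable H).enorm.pow_const 2)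
    (ENNReal.ofReal (l ^ 2 / 4))
  have hHn : ∫⁻ x, ‖H x‖ₑ ^ 2 = ∫⁻ ξ in {ξ : E N | l ≤ 2 * D * ‖ξ‖ ^ a}, ‖U ξ‖ₑ ^ 2 := by
    rw [lintegral_enorm_sq_fourierInv, ← hset, ← lintegral_indicator measurableSet_ball.compl]
    refine lintegral_congr_ae ?_
    filter_upwards [hmH.coeFn_toLp] with ξ h
    rw [h]
    by_cases hξ : ξ ∈ (ball (0 : E N) R)ᶜ
    · rw [Set.indicator_of_mem hξ, Set.indicator_of_mem hξ]
    · rw [Set.indicator_of_notMem hξ, Set.indicator_of_notMem hξ]; simp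
  rw [hHn] at hcheb
  refine (measure_mono_ae hsub).trans ?_
  have e : ENNReal.ofReal (4 / l ^ 2) = (ENNReal.ofReal (l ^ 2 / 4))⁻¹ := by
    rw [← ENNReal.ofReal_inv_of_pos (by positivity), inv_div]
  rw [e, ← ENNReal.div_eq_inv_mul, ENNReal.le_div_iff_mul_le (Or.inl (by positivity)) (by simp)]
  rwa [mul_comm]

lemma two_lt_critExp (hs : 0 < s) (hN : 2 * s < N) : 2 < critExp N s := by
  rw [critExp, lt_div_iff₀ (by linarith)]; linarith

/-- The fractional Sobolev embedding `H^s(ℝ^N) ⊂ L^{2*_s}(ℝ^N)`. -/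
theorem integrable_abs_rpow_critExp (hs : 0 < s) (hN : 2 * s < N) (u : Hs N s) :
    Integrable fun x => |u.1 x| ^ critExp N s := by
  obtain ⟨D, hD, hlow⟩ := exists_lowFreq_bound hs hN u
  have hp := two_lt_critExp hs hN
  set p := critExp N s with hpdef
  have ha : 0 < (N : ℝ) / 2 - s := by linarith
  set a : ℝ := N / 2 - s with hadef
  -- This exponent identity is what singles out the critical exponent: the final `ξ`-integral
  -- becomes the kinetic one.
  have hap : a * (p - 2) = 2 * s := by
    have : (N : ℝ) - 2 * s ≠ 0 := by linarith
    rw [hpdef, critExp, hadef]; field_simp; ring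
  have hum : AEMeasurable (fun x => |u.1 x|) volume :=
    (Lp.aestronglyMeasurable u.1).norm.aemeasurable
  refine ⟨(hum.pow_const p).aestronglyMeasurable, ?_⟩
  have hUm : Measurable fun ξ => ‖fourierL2 u.1 ξ‖ₑ ^ 2 :=
    (Lp.stronglyMeasurable (fourierL2 u.1)).measurable.enorm.pow_const 2
  -- Layer cake in the level `l`, with a cutoff frequency depending on `l`; after Tonelli, each `ξ`
  -- contributes only for `l ≤ 2 * D * ‖ξ‖ ^ a`. The power `l ^ (p - 3)` is integrable at `0`
  -- because `p > 2`.
  have key : ∫⁻ x, ENNReal.ofReal (|u.1 x| ^ p) < ⊤ := by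
    rw [lintegral_rpow_eq_lintegral_meas_lt_mul volume (ae_of_all _ fun x => abs_nonneg _) hum
      (by linarith)]
    refine ENNReal.mul_lt_top ENNReal.ofReal_lt_top ?_
    let A : Set (ℝ × E N) := {z | z.1 ≤ 2 * D * ‖z.2‖ ^ a}
    have hA : MeasurableSet A := measurableSet_le measurable_fst
      ((measurable_snd.norm.pow_const a).const_mul _)
    let F : ℝ × E N → ℝ≥0∞ := A.indicator fun z =>
      ENNReal.ofReal (4 * z.1 ^ (p - 3)) * ‖fourierL2 u.1 z.2‖ₑ ^ 2
    have hF : Measurable F := by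
      refine Measurable.indicator (Measurable.mul ?_ (hUm.comp measurable_snd)) hA
      exact ((measurable_fst.pow_const _).const_mul _).ennreal_ofReal
    have step1 : ∀ l ∈ Set.Ioi (0 : ℝ),
        volume {x | l < |u.1 x|} * ENNReal.ofReal (l ^ (p - 1)) ≤ ∫⁻ ξ, F (l, ξ) := by
      intro l hl
      have hl : 0 < l := hl
      refine (mul_le_mul_left (meas_lt_abs_le u hD ha hlow hl) _).trans_eq ?_
      have hm : MeasurableSet {ξ : E N | l ≤ 2 * D * ‖ξ‖ ^ a} :=
        measurableSet_le measurable_const ((measurable_norm.pow_const a).const_mul _)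
      rw [mul_right_comm, ← ENNReal.ofReal_mul (by positivity), ← lintegral_indicator hm,
        ← lintegral_const_mul _ (hUm.indicator hm)]
      refine lintegral_congr fun ξ => ?_
      have e : 4 / l ^ 2 * l ^ (p - 1) = 4 * l ^ (p - 3) := by
        rw [show p - 3 = (p - 1) - 2 by ring, Real.rpow_sub hl (p - 1), Real.rpow_two]; ring
      by_cases hξ : l ≤ 2 * D * ‖ξ‖ ^ a
      · rw [Set.indicator_of_mem (show ξ ∈ {ξ : E N | l ≤ 2 * D * ‖ξ‖ ^ a} from hξ)]
        simp only [F]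
        rw [Set.indicator_of_mem (show (l, ξ) ∈ A from hξ), e]
      · rw [Set.indicator_of_notMem (show ξ ∉ {ξ : E N | l ≤ 2 * D * ‖ξ‖ ^ a} from hξ)]
        simp only [F]
        rw [Set.indicator_of_notMem (show (l, ξ) ∉ A from hξ), mul_zero]
    refine (setLIntegral_mono' measurableSet_Ioi step1).trans_lt ?_
    rw [lintegral_lintegral_swap (f := fun l ξ => F (l, ξ)) hF.aemeasurable]
    have step2 : ∀ ξ : E N, ∫⁻ l in Set.Ioi (0 : ℝ), F (l, ξ) ≤
        ENNReal.ofReal (4 * (2 * D) ^ (p - 2) / (p - 2) * (2 * Real.pi) ^ (-(2 * s)))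
          * ‖symbolMul s u.1 ξ‖ₑ ^ 2 := by
      intro ξ
      set L : ℝ := 2 * D * ‖ξ‖ ^ a with hL
      have hL0 : 0 ≤ L := by positivity
      have e1 : ∫⁻ l in Set.Ioi (0 : ℝ), F (l, ξ)
          = ∫⁻ l in Set.Ioc 0 L, ENNReal.ofReal (4 * l ^ (p - 3)) * ‖fourierL2 u.1 ξ‖ₑ ^ 2 := by
        rw [← lintegral_indicator measurableSet_Ioi, ← lintegral_indicator measurableSet_Ioc]
        refine lintegral_congr fun l => ?_
        by_cases h1 : 0 < l <;> by_cases h2 : l ≤ L <;>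
          simp [F, A, Set.indicator, h1, h2, ← hL]
      have e2 : ∫⁻ l in Set.Ioc 0 L, ENNReal.ofReal (4 * l ^ (p - 3))
          = ENNReal.ofReal (4 * (L ^ (p - 2) / (p - 2))) := by
        have hint : IntegrableOn (fun l : ℝ => 4 * l ^ (p - 3)) (Set.Ioc 0 L) :=
          ((intervalIntegrable_iff_integrableOn_Ioc_of_le hL0).1
            (intervalIntegral.intervalIntegrable_rpow' (by linarith))).const_mul 4
        rw [← ofReal_integral_eq_lintegral_ofReal hint
          ((ae_restrict_iff' measurableSet_Ioc).2 (ae_of_all _ fun l hl => by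
            have := hl.1; change (0:ℝ) ≤ _; positivity)), integral_const_mul,
          ← intervalIntegral.integral_of_le hL0, integral_rpow (Or.inl (by linarith)),
          show p - 3 + 1 = p - 2 by ring, Real.zero_rpow (by linarith), sub_zero]
      rw [e1, lintegral_mul_const' _ _ (by finiteness), e2, ← ofReal_norm, ← ofReal_norm,
        ← ENNReal.ofReal_pow (norm_nonneg _), ← ENNReal.ofReal_pow (norm_nonneg _),
        ← ENNReal.ofReal_mul (by have : 0 < p - 2 := by linarith
                                 positivity), ← ENNReal.ofReal_mul (by
          have : 0 < p - 2 := by linarith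
          positivity)]
      refine le_of_eq ?_
      congr 1
      rw [norm_symbolMul, hL, Real.mul_rpow (by positivity) (by positivity),
        ← Real.rpow_mul (norm_nonneg _), hap, mul_pow, ← Real.rpow_mul_natCast (by positivity),
        Real.mul_rpow (by positivity) (norm_nonneg ξ), Real.rpow_neg (by positivity)]
      have : (2 * Real.pi) ^ (2 * s) ≠ 0 := by positivity
      have e3 : s * ((2 : ℕ) : ℝ) = 2 * s := by push_cast; ring
      rw [e3]
      field_simp
    refine (lintegral_mono step2).trans_lt ?_
    have hS : ∫⁻ ξ, ‖symbolMul s u.1 ξ‖ₑ ^ 2 < ⊤ := by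
      have h2 : Integrable fun ξ => ‖symbolMul s u.1 ξ‖ ^ 2 :=
        (show MemLp (symbolMul s u.1) 2 volume from u.2).integrable_norm_pow two_ne_zero
      simpa [HasFiniteIntegral] using h2.2
    rw [lintegral_const_mul' _ _ ENNReal.ofReal_ne_top]
    exact ENNReal.mul_lt_top ENNReal.ofReal_lt_top hS
  refine lt_of_eq_of_lt (lintegral_congr fun x => ?_) key
  rw [Real.enorm_of_nonneg (by positivity)]

/-! ### Growth of `g` and `G`, and differentiation of `∫ G(u + τ φ)`. -/

section Nonlinearity

variable {g : ℝ → ℝ}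

lemma hasDerivAt_primitive (hg : Continuous g) (t : ℝ) : HasDerivAt (primitive g) (g t) t :=
  intervalIntegral.integral_hasDerivAt_right (hg.intervalIntegrable _ _)
    (hg.stronglyMeasurableAtFilter _ _) hg.continuousAt

lemma continuous_primitive (hg : Continuous g) : Continuous (primitive g) :=
  continuous_iff_continuousAt.2 fun t => (hasDerivAt_primitive hg t).continuousAt

lemma primitive_zero : primitive g 0 = 0 := by simp [primitive]

lemma exists_primitive_add_eq (hg : Continuous g) (a h : ℝ) :
    ∃ θ ∈ Set.Ioo (0 : ℝ) 1, primitive g (a + h) - primitive g a = g (a + θ * h) * h := by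
  have hd : ∀ θ : ℝ, HasDerivAt (fun θ => primitive g (a + θ * h)) (g (a + θ * h) * h) θ :=
    fun θ => (hasDerivAt_primitive hg _).comp θ
      (((hasDerivAt_id θ).mul_const h).const_add a |>.congr_deriv (by simp))
  obtain ⟨θ, hθ, e⟩ := exists_hasDerivAt_eq_slope (fun θ => primitive g (a + θ * h))
    (fun θ => g (a + θ * h) * h) zero_lt_one
    (fun θ _ => (hd θ).continuousAt.continuousWithinAt) fun θ _ => hd θ
  exact ⟨θ, hθ, by simpa using e.symm⟩

lemma exists_growth_bound {q : ℝ} (hg : Continuous g)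
    (hg2 : limsup (fun t : ℝ => ((|g t| / |t| ^ q : ℝ) : EReal)) (Bornology.cobounded ℝ) < ⊤) :
    ∃ C : ℝ, 0 < C ∧ ∀ t, |g t| ≤ C * (1 + |t| ^ q) := by
  obtain ⟨c, hc, -⟩ := EReal.lt_iff_exists_real_btwn.1 hg2
  have hev := eventually_lt_of_limsup_lt hc
  rw [(Metric.hasBasis_cobounded_compl_closedBall (0 : ℝ)).eventually_iff] at hev
  obtain ⟨r, -, hr⟩ := hev
  obtain ⟨C₁, hC₁⟩ := (isCompact_closedBall (0 : ℝ) (max r 0)).exists_bound_of_continuousOn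
    hg.continuousOn
  refine ⟨max (max C₁ c) 1, by positivity, fun t => ?_⟩
  have hC : 0 < max (max C₁ c) 1 := by positivity
  have hq : 0 ≤ |t| ^ q := by positivity
  by_cases ht : t ∈ Metric.closedBall (0 : ℝ) (max r 0)
  · have h1 : |g t| ≤ max (max C₁ c) 1 :=
      (hC₁ t ht).trans ((le_max_left _ _).trans (le_max_left _ _))
    nlinarith
  · have h1 := hr fun h => ht (Metric.closedBall_subset_closedBall (le_max_left _ _) h)
    rw [EReal.coe_lt_coe_iff] at h1
    have h2 : |g t| / |t| ^ q ≤ max (max C₁ c) 1 :=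
      h1.le.trans ((le_max_right _ _).trans (le_max_left _ _))
    have h0 : t ≠ 0 := fun h0 => ht (by simp [h0])
    have : 0 < |t| ^ q := by positivity
    rw [div_le_iff₀ this] at h2
    nlinarith

/-- The limsup condition is one-sided; multiplying by `t` treats both signs at once. With no lower
bound near `0`, `∫ G(u) = -∞` is not excluded a priori. -/
lemma exists_mul_self_le_sq (hg_zero : g 0 = 0)
    (hg1 : limsup (fun t : ℝ => ((g t / t : ℝ) : EReal)) (𝓝[≠] 0) ≤ 0) :
    ∃ δ : ℝ, 0 < δ ∧ ∀ t, |t| < δ → g t * t ≤ t ^ 2 := by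
  have hev := eventually_lt_of_limsup_lt (hg1.trans_lt (zero_lt_one (α := EReal)))
  rw [eventually_nhdsWithin_iff, Metric.eventually_nhds_iff] at hev
  obtain ⟨δ, hδ, h⟩ := hev
  refine ⟨δ, hδ, fun t ht => ?_⟩
  rcases eq_or_ne t 0 with rfl | h0
  · simp [hg_zero]
  · have h1 : g t / t < 1 := by exact_mod_cast h (by simpa using ht) h0
    have h2 : g t * t = g t / t * t ^ 2 := by field_simp
    rw [h2]
    have : 0 < t ^ 2 := by positivity
    nlinarith

/-- For `|t| < δ` the quadratic bound applies at the mean-value point. For `|t| ≥ δ` the linear term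
of the growth bound is absorbed by `|t| ≤ t ^ 2 / δ`, whence the summand `C / δ`. -/
lemma exists_primitive_le {p : ℝ} (hp : 1 ≤ p) (hg : Continuous g) {C δ : ℝ} (hC : 0 < C)
    (hgrow : ∀ t, |g t| ≤ C * (1 + |t| ^ (p - 1))) (hδ : 0 < δ)
    (hsmall : ∀ t, |t| < δ → g t * t ≤ t ^ 2) (t : ℝ) :
    primitive g t ≤ (1 + C / δ + C) * (t ^ 2 + |t| ^ p) := by
  obtain ⟨θ, ⟨hθ0, hθ1⟩, e⟩ := exists_primitive_add_eq hg 0 t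
  rw [primitive_zero, sub_zero, zero_add, zero_add] at e
  rw [e]
  have hθt : |θ * t| ≤ |t| := by
    rw [abs_mul, abs_of_pos hθ0]; exact mul_le_of_le_one_left (abs_nonneg _) hθ1.le
  have hP : 0 ≤ |t| ^ p := by positivity
  have hCδ : 0 < C / δ := by positivity
  rcases lt_or_ge |t| δ with ht | ht
  · have h1 := hsmall (θ * t) (hθt.trans_lt ht)
    have h2 : θ * (g (θ * t) * t) ≤ θ * (θ * t ^ 2) := by nlinarith
    have h3 := le_of_mul_le_mul_left h2 hθ0
    nlinarith [sq_nonneg t, mul_nonneg hCδ.le (sq_nonneg t), mul_nonneg hCδ.le hP,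
      mul_nonneg hC.le (sq_nonneg t), mul_nonneg hC.le hP]
  · have ht0 : 0 < |t| := hδ.trans_le ht
    have h1 : g (θ * t) * t ≤ C * (1 + |t| ^ (p - 1)) * |t| := by
      refine (le_abs_self _).trans ?_
      rw [abs_mul]
      refine mul_le_mul_of_nonneg_right ((hgrow _).trans ?_) ht0.le
      have : |θ * t| ^ (p - 1) ≤ |t| ^ (p - 1) :=
        Real.rpow_le_rpow (abs_nonneg _) hθt (by linarith)
      gcongr
    have h2 : |t| ^ (p - 1) * |t| = |t| ^ p := by
      rw [← Real.rpow_add_one ht0.ne', sub_add_cancel]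
    have h3 : C * |t| ≤ C / δ * t ^ 2 := by
      rw [← sq_abs t, div_mul_eq_mul_div, le_div_iff₀ hδ]
      nlinarith [mul_nonneg hC.le ht0.le]
    nlinarith [sq_nonneg t, mul_nonneg hCδ.le (sq_nonneg t), mul_nonneg hCδ.le hP,
      mul_nonneg hC.le (sq_nonneg t), mul_nonneg hC.le hP]

lemma aestronglyMeasurable_comp {h : ℝ → ℝ} (hh : Continuous h) (u : L2 N) :
    AEStronglyMeasurable (fun x => h (u x)) volume :=
  hh.comp_aestronglyMeasurable (Lp.aestronglyMeasurable u)

lemma lintegral_primitive_ne_top (hs : 0 < s) (hN : 2 * s < N) {K : ℝ}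
    (hG : ∀ t, primitive g t ≤ K * (t ^ 2 + |t| ^ critExp N s)) (u : Hs N s) :
    ∫⁻ x, ENNReal.ofReal (primitive g (u.1 x)) ≠ ⊤ := by
  have hi : Integrable fun x => K * ((u.1 x) ^ 2 + |u.1 x| ^ critExp N s) :=
    ((integrable_sq u).add (integrable_abs_rpow_critExp hs hN u)).const_mul K
  refine ((lintegral_mono fun x => ENNReal.ofReal_le_ofReal (hG _)).trans_lt
    ((lintegral_ofReal_le_lintegral_enorm _).trans_lt hi.2)).ne

/-- The dominating function for `g (u + τ φ) φ`, `|τ| ≤ 1`. -/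
lemma abs_mul_le_of_growth {p C : ℝ} (hp : 1 < p) (hC : 0 < C)
    (hgrow : ∀ t, |g t| ≤ C * (1 + |t| ^ (p - 1))) {a b τ : ℝ} (hτ : |τ| ≤ 1) :
    |g (a + τ * b) * b| ≤ C * |b| + C * 2 ^ p * (|a| ^ p + |b| ^ p) := by
  have hab : |a + τ * b| ≤ |a| + |b| := by
    refine (abs_add_le _ _).trans ?_
    rw [abs_mul]
    nlinarith [abs_nonneg b]
  have hmax : |a| + |b| ≤ 2 * max |a| |b| := by
    linarith [le_max_left |a| |b|, le_max_right |a| |b|]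
  have hm0 : 0 ≤ max |a| |b| := (abs_nonneg a).trans (le_max_left _ _)
  have h1 : |a + τ * b| ^ (p - 1) * |b| ≤ (2 * max |a| |b|) ^ p := by
    have e : (2 * max |a| |b|) ^ p = (2 * max |a| |b|) ^ (p - 1) * (2 * max |a| |b|) := by
      rw [← Real.rpow_add_one' (by positivity) (by linarith), sub_add_cancel]
    rw [e]
    refine mul_le_mul (Real.rpow_le_rpow (abs_nonneg _) (hab.trans hmax) (by linarith)) ?_
      (abs_nonneg _) (by positivity)
    linarith [le_max_right |a| |b|]
  have h2 : (max |a| |b|) ^ p ≤ |a| ^ p + |b| ^ p := by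
    rcases max_choice |a| |b| with h | h <;> rw [h]
    · linarith [Real.rpow_nonneg (abs_nonneg b) p]
    · linarith [Real.rpow_nonneg (abs_nonneg a) p]
  rw [Real.mul_rpow (by norm_num) hm0] at h1
  calc |g (a + τ * b) * b| = |g (a + τ * b)| * |b| := abs_mul _ _
    _ ≤ C * (1 + |a + τ * b| ^ (p - 1)) * |b| := by gcongr; exact hgrow _
    _ = C * |b| + C * (|a + τ * b| ^ (p - 1) * |b|) := by ring
    _ ≤ C * |b| + C * (2 ^ p * (|a| ^ p + |b| ^ p)) := by
        have h3 := h1.trans (mul_le_mul_of_nonneg_left h2 (by positivity))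
        linarith [mul_le_mul_of_nonneg_left h3 hC.le]
    _ = _ := by ring

section Derivative

variable {C : ℝ} {u φ : Hs N s}

/-- The constant in the growth bound of `g` produces the term `C * |φ|`; this is where `φ ∈ L¹`
enters. -/
lemma integrable_dominating (hs : 0 < s) (hN : 2 * s < N) (hφ : Integrable fun x => φ.1 x) :
    Integrable fun x => C * |φ.1 x| + C * 2 ^ critExp N s *
      (|u.1 x| ^ critExp N s + |φ.1 x| ^ critExp N s) :=
  (hφ.abs.const_mul C).add (((integrable_abs_rpow_critExp hs hN u).add
    (integrable_abs_rpow_critExp hs hN φ)).const_mul _)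

lemma aestronglyMeasurable_comp_add_mul {h : ℝ → ℝ} (hh : Continuous h) (τ : ℝ) :
    AEStronglyMeasurable (fun x => h (u.1 x + τ * φ.1 x)) volume :=
  hh.comp_aestronglyMeasurable ((Lp.aestronglyMeasurable u.1).add
    ((Lp.aestronglyMeasurable φ.1).const_mul τ))

lemma integrable_comp_mul (hs : 0 < s) (hN : 2 * s < N) (hg : Continuous g) (hC : 0 < C)
    (hgrow : ∀ t, |g t| ≤ C * (1 + |t| ^ (critExp N s - 1)))
    (hφ : Integrable fun x => φ.1 x) : Integrable fun x => g (u.1 x) * φ.1 x := by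
  refine (integrable_dominating (C := C) (u := u) hs hN hφ).mono'
    ((aestronglyMeasurable_comp hg u.1).mul (Lp.aestronglyMeasurable φ.1)) (ae_of_all _ fun x => ?_)
  have hp := two_lt_critExp hs hN
  simpa using abs_mul_le_of_growth (by linarith) hC hgrow (a := u.1 x) (b := φ.1 x) (τ := 0)
    (by simp)

/-- Integrability passes from `G(u)` to `G(u + τ φ)` because the mean value theorem dominates their
difference. -/
lemma integrable_primitive_add_mul (hs : 0 < s) (hN : 2 * s < N) (hg : Continuous g) (hC : 0 < C)
    (hgrow : ∀ t, |g t| ≤ C * (1 + |t| ^ (critExp N s - 1)))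
    (hu : Integrable fun x => primitive g (u.1 x)) (hφ : Integrable fun x => φ.1 x)
    {τ : ℝ} (hτ : |τ| ≤ 1) : Integrable fun x => primitive g (u.1 x + τ * φ.1 x) := by
  have hp := two_lt_critExp hs hN
  have hd : Integrable fun x => primitive g (u.1 x + τ * φ.1 x) - primitive g (u.1 x) := by
    refine (integrable_dominating (C := C) (u := u) hs hN hφ).mono'
      ((aestronglyMeasurable_comp_add_mul (continuous_primitive hg) τ).sub hu.1)
      (ae_of_all _ fun x => ?_)
    obtain ⟨θ, ⟨hθ0, hθ1⟩, e⟩ := exists_primitive_add_eq hg (u.1 x) (τ * φ.1 x)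
    have hθτ : |θ * τ| ≤ 1 := by
      rw [abs_mul, abs_of_pos hθ0]; nlinarith [abs_nonneg τ]
    have h1 := abs_mul_le_of_growth (by linarith) hC hgrow (a := u.1 x) (b := φ.1 x) hθτ
    rw [Real.norm_eq_abs, e]
    refine le_trans ?_ h1
    rw [mul_assoc θ, mul_left_comm _ τ, abs_mul τ]
    exact mul_le_of_le_one_left (abs_nonneg _) hτ
  refine (hd.add hu).congr (ae_of_all _ fun x => ?_)
  simp

lemma hasDerivAt_integral_primitive (hs : 0 < s) (hN : 2 * s < N) (hg : Continuous g)
    (hC : 0 < C) (hgrow : ∀ t, |g t| ≤ C * (1 + |t| ^ (critExp N s - 1)))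
    (hu : Integrable fun x => primitive g (u.1 x)) (hφ : Integrable fun x => φ.1 x) :
    HasDerivAt (fun τ : ℝ => ∫ x, primitive g (u.1 x + τ * φ.1 x)) (∫ x, g (u.1 x) * φ.1 x) 0 := by
  have hp := two_lt_critExp hs hN
  have h := hasDerivAt_integral_of_dominated_loc_of_deriv_le (μ := (volume : Measure (E N)))
    (F := fun (τ : ℝ) x => primitive g (u.1 x + τ * φ.1 x))
    (F' := fun (τ : ℝ) x => g (u.1 x + τ * φ.1 x) * φ.1 x) (x₀ := 0)
    (s := Metric.ball 0 1) (Metric.ball_mem_nhds _ one_pos)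
    (Eventually.of_forall fun τ => aestronglyMeasurable_comp_add_mul (continuous_primitive hg) τ)
    (by simpa using hu)
    ((aestronglyMeasurable_comp_add_mul hg 0).mul (Lp.aestronglyMeasurable φ.1))
    (ae_of_all _ fun x τ hτ => abs_mul_le_of_growth (by linarith) hC hgrow
      (by simpa using (Metric.mem_ball.1 hτ).le))
    (integrable_dominating (C := C) (u := u) hs hN hφ)
    (ae_of_all _ fun x τ _ => (hasDerivAt_primitive hg _).comp τ
      (((hasDerivAt_id τ).mul_const (φ.1 x)).const_add (u.1 x) |>.congr_deriv (by simp)))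
  simpa using h.2

end Derivative

end Nonlinearity

/-! ### Rescaling to a prescribed mass, and a finite-energy competitor. -/

lemma critExp_pos (hs : 0 < s) (hN : 2 * s < N) : 0 < critExp N s := by
  linarith [two_lt_critExp hs hN]

/-- Dilation of `v ∈ H^s(ℝ^N)` multiplying the mass by a prescribed `c > 0`. -/
lemma exists_rescaling (hs : 0 < s) (hN : 2 * s < N) (v : Hs N s) {c : ℝ} (hc : 0 < c) :
    ∃ w : Hs N s, mass w = c * mass v ∧ kinetic w = c ^ (2 / critExp N s) * kinetic v ∧
      ∀ h : ℝ → ℝ, Integrable (fun x => h (v.1 x)) →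
        Integrable (fun x => h (w.1 x)) ∧ ∫ x, h (w.1 x) = c * ∫ x, h (v.1 x) := by
  have hN0 : (0 : ℝ) < N := by linarith
  -- Chosen so that `t ^ (-N) = c`; the kinetic factor is then `t ^ (2s - N) = c ^ (1 - 2s/N) = c ^
  -- (2 / critExp N s)`.
  set t : ℝ := c ^ (-(1 / (N : ℝ))) with ht
  have ht0 : 0 < t := by positivity
  have htN : (t ^ N)⁻¹ = c := by
    rw [ht, ← Real.rpow_natCast, ← Real.rpow_mul hc.le, ← Real.rpow_neg hc.le]
    field_simp
    exact Real.rpow_one c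
  obtain ⟨w, hw, hk⟩ := exists_dilation v ht0
  have hint : ∀ h : ℝ → ℝ, ∫ x, h (w.1 x) = c * ∫ x, h (v.1 x) := fun h => by
    have h1 := Measure.integral_comp_smul_of_nonneg (volume : Measure (E N))
      (fun x => h (v.1 x)) t (hR := ht0.le)
    rw [finrank_euclideanSpace_fin, htN, smul_eq_mul] at h1
    rw [← h1]
    exact integral_congr_ae (hw.mono fun x hx => by simp only [hx])
  refine ⟨w, hint fun y => y ^ 2, ?_, fun h hh => ⟨?_, hint h⟩⟩
  · rw [hk, htN, ht, ← Real.rpow_mul hc.le]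
    congr 1
    conv_lhs => lhs; rw [← Real.rpow_one c]
    rw [← Real.rpow_add hc, critExp]
    congr 1
    field_simp
    ring
  · exact (hh.comp_smul ht0.ne').congr (hw.mono fun x hx => by simp only [hx])

lemma energy_of_integrable {g : ℝ → ℝ} {u : Hs N s}
    (hu : Integrable fun x => primitive g (u.1 x)) :
    energy g u = ((1 / 2 * kinetic u - ∫ x, primitive g (u.1 x) : ℝ) : EReal) := by
  rw [energy, extIntegral_of_integrable hu, EReal.coe_sub]

lemma lagrangian_of_integrable {g : ℝ → ℝ} {m μ : ℝ} {u : Hs N s}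
    (hu : Integrable fun x => primitive g (u.1 x)) :
    lagrangian g m μ u =
      ((1 / 2 * kinetic u + μ / 2 * (mass u - m) - ∫ x, primitive g (u.1 x) : ℝ) : EReal) := by
  rw [lagrangian, extIntegral_of_integrable hu, EReal.coe_sub]

lemma integrable_primitive_of_energy_lt_top {g : ℝ → ℝ} (hg : Continuous g) {u : Hs N s}
    (hpos : ∫⁻ x, ENNReal.ofReal (primitive g (u.1 x)) ≠ ⊤) (h : energy g u < ⊤) :
    Integrable fun x => primitive g (u.1 x) := by
  refine integrable_of_extIntegral (aestronglyMeasurable_comp (continuous_primitive hg) u.1) hpos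
    fun hneg => h.ne ?_
  rw [energy, extIntegral, hneg, ← EReal.coe_ennreal_toReal hpos, EReal.coe_ennreal_top]
  rfl

-- The symbol need not be smooth at the origin, but for `0 ≤ s ≤ 1` it is bounded by `1 + 2π‖ξ‖`.
open SchwartzMap in
lemma memLp_rpow_mul_schwartz (hs0 : 0 ≤ s) (hs1 : s ≤ 1) (ψ : 𝓢(E N, ℂ)) :
    MemLp (fun ξ => (((2 * Real.pi * ‖ξ‖) ^ s : ℝ) : ℂ) * ψ ξ) 2 volume := by
  have h1 : MemLp (fun ξ => (2 * Real.pi * ‖ξ‖) * ‖ψ ξ‖) 2 volume := by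
    rw [memLp_two_iff_integrable_sq (by fun_prop)]
    obtain ⟨M, hM⟩ : ∃ M, ∀ x, ‖ψ x‖ ≤ M := ⟨_, ψ.norm_le_seminorm ℝ⟩
    refine ((ψ.integrable_pow_mul volume 2).const_mul ((2 * Real.pi) ^ 2 * M)).mono'
      (by fun_prop) (ae_of_all _ fun ξ => ?_)
    rw [Real.norm_of_nonneg (by positivity)]
    calc (2 * Real.pi * ‖ξ‖ * ‖ψ ξ‖) ^ 2
        = (2 * Real.pi) ^ 2 * (‖ξ‖ ^ 2 * ‖ψ ξ‖) * ‖ψ ξ‖ := by ring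
      _ ≤ (2 * Real.pi) ^ 2 * (‖ξ‖ ^ 2 * ‖ψ ξ‖) * M := by gcongr; exact hM ξ
      _ = _ := by ring
  refine ((ψ.memLp 2 volume).norm.add h1).mono ?_ (ae_of_all _ fun ξ => ?_)
  · have : Continuous fun ξ : E N => (2 * Real.pi * ‖ξ‖) ^ s :=
      Continuous.rpow_const (by fun_prop) fun _ => Or.inr hs0
    exact ((Complex.continuous_ofReal.comp this).mul ψ.continuous).aestronglyMeasurable
  · have hA : 0 ≤ 2 * Real.pi * ‖ξ‖ := by positivity
    have h2 : (2 * Real.pi * ‖ξ‖) ^ s ≤ 1 + 2 * Real.pi * ‖ξ‖ := by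
      rcases le_total (2 * Real.pi * ‖ξ‖) 1 with h | h
      · linarith [Real.rpow_le_one hA h hs0]
      · have := Real.rpow_le_rpow_of_exponent_le h hs1
        rw [Real.rpow_one] at this
        linarith
    rw [norm_mul, Complex.norm_real, Real.norm_of_nonneg (by positivity), Pi.add_apply,
      Real.norm_of_nonneg (by positivity)]
    nlinarith [norm_nonneg (ψ ξ)]

/-- There is a nonzero element of `H^s(ℝ^N)` along which every continuous function vanishing at
`0` is integrable. -/
lemma exists_test_function (N : ℕ) (hs0 : 0 ≤ s) (hs1 : s ≤ 1) :
    ∃ v : Hs N s, v ≠ 0 ∧ ∀ h : ℝ → ℝ, Continuous h → h 0 = 0 →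
      Integrable fun x => h (v.1 x) := by
  let f : ContDiffBump (0 : E N) := ⟨1, 2, one_pos, one_lt_two⟩
  have hfC : HasCompactSupport (fun x => (f x : ℂ)) :=
    f.hasCompactSupport.comp_left (g := ((↑) : ℝ → ℂ)) rfl
  have hfS : ContDiff ℝ (↑(⊤ : ℕ∞)) (fun x => (f x : ℂ)) := Complex.ofRealCLM.contDiff.comp f.contDiff
  set ψ := hfC.toSchwartzMap hfS
  let v : L2 N := (f.continuous.memLp_of_hasCompactSupport (p := 2) f.hasCompactSupport).toLp
  have hv : v =ᵐ[volume] f := MemLp.coeFn_toLp _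
  have hF : fourierL2 v = (𝓕 ψ).toLp 2 volume := by
    have e : Complex.ofRealCLM.compLpL 2 (volume : Measure (E N)) v = ψ.toLp 2 volume := by
      apply Lp.ext
      filter_upwards [coeFn_compLpL_ofReal v, hv, ψ.coeFn_toLp 2 volume] with x h1 h2 h3
      rw [h1, h2, h3]
      rfl
    rw [fourierL2, e, SchwartzMap.toLp_fourier_eq]
  have hS : symbolMul s v =ᵐ[volume] fun ξ => (((2 * Real.pi * ‖ξ‖) ^ s : ℝ) : ℂ) * (𝓕 ψ) ξ := by
    filter_upwards [(𝓕 ψ).coeFn_toLp 2 volume] with ξ h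
    rw [symbolMul, hF, h]
  refine ⟨⟨v, (memLp_congr_ae hS).2 (memLp_rpow_mul_schwartz hs0 hs1 _)⟩, fun h0 => ?_,
    fun h hh h0 => ?_⟩
  · have h1 : v = 0 := congrArg Subtype.val h0
    have h2 : (f : E N → ℝ) =ᵐ[volume] fun _ => 0 := by
      rw [h1] at hv
      exact hv.symm.trans (Lp.coeFn_zero ℝ 2 volume)
    have h3 := congrFun ((f.continuous.ae_eq_iff_eq _ continuous_const).1 h2) 0
    rw [f.one_of_mem_closedBall (by simp [f])] at h3
    exact one_ne_zero h3
  · exact ((hh.comp f.continuous).integrable_of_hasCompactSupport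
      (f.hasCompactSupport.comp_left h0)).congr (hv.mono fun x hx => by simp [hx])

lemma exists_mem_sphere_integrable (hs0 : 0 < s) (hs1 : s ≤ 1) (hN : 2 * s < N) {m : ℝ}
    (hm : 0 < m) {h : ℝ → ℝ} (hh : Continuous h) (h0 : h 0 = 0) :
    ∃ w ∈ sphere N s m, Integrable fun x => h (w.1 x) := by
  obtain ⟨v, hv, hint⟩ := exists_test_function (s := s) N hs0.le hs1
  obtain ⟨w, h1, -, h2⟩ := exists_rescaling hs0 hN v (div_pos hm (mass_pos hv))
  exact ⟨w, by rw [sphere, Set.mem_ofPred_eq, h1, div_mul_cancel₀ _ (mass_pos hv).ne'],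
    (h2 h (hint h hh h0)).1⟩

/-! ### Consequences of minimality on the sphere. -/

section Minimizer

variable {g : ℝ → ℝ} {m : ℝ} {u : Hs N s}

/-- A minimizer on the sphere is compared with all dilations of elements of `H^s(ℝ^N)`. -/
lemma energy_le_rescaled (hs : 0 < s) (hN : 2 * s < N) (hm : 0 < m)
    (hmin : energy g u = ⨅ v ∈ sphere N s m, energy g v)
    (hu : Integrable fun x => primitive g (u.1 x)) {v : Hs N s} (hv : 0 < mass v)
    (hvi : Integrable fun x => primitive g (v.1 x)) :
    1 / 2 * kinetic u - ∫ x, primitive g (u.1 x) ≤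
      1 / 2 * ((m / mass v) ^ (2 / critExp N s) * kinetic v)
        - m / mass v * ∫ x, primitive g (v.1 x) := by
  obtain ⟨w, h1, h2, h3⟩ := exists_rescaling hs hN v (div_pos hm hv)
  obtain ⟨h4, h5⟩ := h3 _ hvi
  have hw : w ∈ sphere N s m := by
    rw [sphere, Set.mem_ofPred_eq, h1, div_mul_cancel₀ _ hv.ne']
  have h6 : energy g u ≤ energy g w := hmin.trans_le (iInf₂_le w hw)
  rw [energy_of_integrable hu, energy_of_integrable h4, EReal.coe_le_coe_iff, h2, h5] at h6
  exact h6

/-- The variation `u + τ φ` leaves the sphere and is brought back by dilation; `Φ τ` is the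
resulting energy. Differentiating the factor `m / M τ` at `0` gives `-(2 * b / m)`, and this is the
source of the multiplier. -/
lemma euler_lagrange_of_minimizer (hs : 0 < s) (hN : 2 * s < N) (hm : 0 < m)
    (hg : Continuous g) {C : ℝ} (hC : 0 < C)
    (hgrow : ∀ t, |g t| ≤ C * (1 + |t| ^ (critExp N s - 1)))
    (hum : mass u = m) (hmin : energy g u = ⨅ v ∈ sphere N s m, energy g v)
    (hu : Integrable fun x => primitive g (u.1 x)) {φ : Hs N s} (hφ : Integrable fun x => φ.1 x) :
    form u φ + 2 / m * ((∫ x, primitive g (u.1 x)) - 1 / critExp N s * kinetic u)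
      * (∫ x, u.1 x * φ.1 x) = ∫ x, g (u.1 x) * φ.1 x := by
  set b := ∫ x, u.1 x * φ.1 x
  set p := critExp N s
  have hp : 0 < p := critExp_pos hs hN
  let A : ℝ → ℝ := fun τ => kinetic u + 2 * τ * form u φ + τ ^ 2 * kinetic φ
  let M : ℝ → ℝ := fun τ => m + 2 * τ * b + τ ^ 2 * mass φ
  let Γ : ℝ → ℝ := fun τ => ∫ x, primitive g (u.1 x + τ * φ.1 x)
  let Φ : ℝ → ℝ := fun τ => 1 / 2 * ((m / M τ) ^ (2 / p) * A τ) - m / M τ * Γ τ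
  have hquad : ∀ c d e : ℝ, HasDerivAt (fun τ : ℝ => c + 2 * τ * d + τ ^ 2 * e) (2 * d) 0 := by
    intro c d e
    have h := ((((hasDerivAt_id (0 : ℝ)).const_mul 2).mul_const d).const_add c).add
      (((hasDerivAt_id (0 : ℝ)).pow 2).mul_const e)
    exact h.congr_deriv (by simp)
  have hM0 : M 0 = m := by simp [M]
  have hA0 : A 0 = kinetic u := by simp [A]
  have hΓ0 : Γ 0 = ∫ x, primitive g (u.1 x) := by simp [Γ]
  have hM : HasDerivAt M (2 * b) 0 := hquad _ _ _
  have hA : HasDerivAt A (2 * form u φ) 0 := hquad _ _ _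
  have hΓ : HasDerivAt Γ (∫ x, g (u.1 x) * φ.1 x) 0 :=
    hasDerivAt_integral_primitive hs hN hg hC hgrow hu hφ
  have hr : HasDerivAt (fun τ => m / M τ) (-(2 * b / m)) 0 := by
    refine ((hasDerivAt_const (0 : ℝ) m).div hM (by rw [hM0]; exact hm.ne')).congr_deriv ?_
    rw [hM0]; field_simp; ring
  have hr0 : m / M 0 = 1 := by rw [hM0, div_self hm.ne']
  have hrp : HasDerivAt (fun τ => (m / M τ) ^ (2 / p)) (-(2 * b / m) * (2 / p)) 0 := by
    refine (hr.rpow_const (Or.inl (by rw [hr0]; exact one_ne_zero))).congr_deriv ?_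
    rw [hr0, Real.one_rpow, mul_one]
  have hΦ := ((hrp.mul hA).const_mul (1 / 2)).sub (hr.mul hΓ)
  have hmin' : IsLocalMin Φ 0 := by
    have h1 : ∀ᶠ τ in 𝓝 (0 : ℝ), 0 < M τ :=
      hM.continuousAt.eventually (lt_mem_nhds (by rw [hM0]; exact hm))
    have h2 : ∀ᶠ τ in 𝓝 (0 : ℝ), |τ| < 1 := by
      filter_upwards [Metric.ball_mem_nhds (0 : ℝ) one_pos] with τ hτ
      simpa using hτ
    filter_upwards [h1, h2] with τ hτ1 hτ2
    have hi := integrable_primitive_add_mul hs hN hg hC hgrow hu hφ hτ2.le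
    have hae : (fun x => primitive g ((u + τ • φ).1 x)) =ᵐ[volume]
        fun x => primitive g (u.1 x + τ * φ.1 x) :=
      (coeFn_add_smul u φ τ).mono fun x hx => by simp only [hx]
    have hMτ : mass (u + τ • φ) = M τ := by rw [mass_add_smul, hum]
    have h := energy_le_rescaled hs hN hm hmin hu (v := u + τ • φ) (by rwa [hMτ])
      (hi.congr hae.symm)
    rw [hMτ, kinetic_add_smul, integral_congr_ae hae] at h
    simpa only [Φ, hr0, hA0, hΓ0, Real.one_rpow, one_mul] using h
  have key := hmin'.hasDerivAt_eq_zero hΦ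
  rw [hr0, hA0, hΓ0, Real.one_rpow] at key
  have : form u φ - 2 * b / m * (1 / p) * kinetic u
      - (-(2 * b / m) * (∫ x, primitive g (u.1 x)) + ∫ x, g (u.1 x) * φ.1 x) = 0 := by
    rw [← key]; ring
  linear_combination this

/-- A real kinetic term cannot cancel an infinite integral, so the constraint itself forces
integrability. -/
lemma integrable_primitive_of_pohozaev_eq_zero (hs : 0 < s) (hN : 2 * s < N) (hg : Continuous g)
    {l : ℝ} {v : Hs N s} (h : pohozaev g l v = 0) :
    Integrable (fun x => primitive g (v.1 x)) ∧
      kinetic v + critExp N s * (l / 2 * mass v - ∫ x, primitive g (v.1 x)) = 0 := by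
  have hp := critExp_pos hs hN
  set f : E N → ℝ := fun x => l / 2 * (v.1 x) ^ 2 - primitive g (v.1 x)
  have hfm : AEStronglyMeasurable f volume := aestronglyMeasurable_comp
    (h := fun y => l / 2 * y ^ 2 - primitive g y)
    ((continuous_const.mul (continuous_pow 2)).sub (continuous_primitive hg)) v.1
  have hsq := (integrable_sq v).const_mul (l / 2)
  have hf : Integrable f := by
    have h' : ((kinetic v : ℝ) : EReal) + (critExp N s : ℝ) * extIntegral f = 0 := h
    obtain ⟨c, hc⟩ : ∃ c : ℝ, extIntegral f = c := by
      induction hx : extIntegral f with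
      | bot => rw [hx, EReal.coe_mul_bot_of_pos hp] at h'; simp at h'
      | top => rw [hx, EReal.coe_mul_top_of_pos hp] at h'; simp at h'
      | coe c => exact ⟨c, rfl⟩
    exact integrable_of_extIntegral_eq_coe hfm hc
  have hG : Integrable fun x => primitive g (v.1 x) :=
    (hsq.sub hf).congr (ae_of_all _ fun x => by simp [f])
  refine ⟨hG, ?_⟩
  have e : ∫ x, f x = l / 2 * mass v - ∫ x, primitive g (v.1 x) := by
    rw [integral_sub hsq hG, integral_const_mul, mass]
  have h' : ((kinetic v : ℝ) : EReal) + (critExp N s : ℝ) * extIntegral f = 0 := h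
  rw [extIntegral_of_integrable hf, e] at h'
  exact_mod_cast h'

/-- The energy of a minimizer is a lower bound of the Lagrangian on the Pohozaev set. -/
lemma energy_le_lagrangian (hs : 0 < s) (hN : 2 * s < N) (hm : 0 < m) (hg : Continuous g)
    (hmin : energy g u = ⨅ v ∈ sphere N s m, energy g v)
    (hu : Integrable fun x => primitive g (u.1 x)) {l : ℝ} {v : Hs N s} (hv : v ≠ 0)
    (hP : pohozaev g l v = 0) : energy g u ≤ lagrangian g m l v := by
  obtain ⟨hG, hP'⟩ := integrable_primitive_of_pohozaev_eq_zero hs hN hg hP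
  have hM := mass_pos hv
  have h := energy_le_rescaled hs hN hm hmin hu hM hG
  rw [energy_of_integrable hu, lagrangian_of_integrable hG, EReal.coe_le_coe_iff]
  refine h.trans ?_
  have hp2 := two_lt_critExp hs hN
  set p := critExp N s
  have hp : 0 < p := by linarith
  set c := m / mass v with hc
  have hc0 : 0 < c := div_pos hm hM
  have hcm : c * mass v = m := div_mul_cancel₀ _ hM.ne'
  -- Bernoulli's inequality: the tangent line at `c = 1` lies above the concave power. Once `∫ G(v)`
  -- is eliminated, the terms in `c` cancel, leaving `(1/2 - 1/p) * kinetic v - l * m / 2`, which is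
  -- the Lagrangian.
  have hB : c ^ (2 / p) ≤ 1 + 2 / p * (c - 1) := by
    have := rpow_one_add_le_one_add_mul_self (s := c - 1) (by linarith) (p := 2 / p)
      (by positivity) ((div_le_one hp).2 hp2.le)
    simpa using this
  have hGv : ∫ x, primitive g (v.1 x) = l / 2 * mass v + kinetic v / p := by
    field_simp
    linarith
  rw [hGv]
  have h1 := mul_le_mul_of_nonneg_right hB (kinetic_nonneg v)
  have e : c * (l / 2 * mass v + kinetic v / p) = l / 2 * m + c * (kinetic v / p) := by
    rw [← hcm]; ring
  rw [e]
  have e2 : (1 + 2 / p * (c - 1)) * kinetic v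
      = kinetic v + 2 * c * (kinetic v / p) - 2 * (kinetic v / p) := by ring
  rw [e2] at h1
  linarith

end Minimizer

end FracNLS

/-! ### Assembly. -/

theorem proposition1p7 (N : ℕ) (s : ℝ) (hs0 : 0 < s) (hs1 : s < 1) (hN : 2 * s < N)
    (m : ℝ) (hm : 0 < m) (g : ℝ → ℝ)
    (hg_cont : Continuous g) (hg_zero : g 0 = 0)
    (hg1 : limsup (fun t : ℝ => ((g t / t : ℝ) : EReal)) (𝓝[≠] 0) ≤ 0)
    (hg2 : limsup (fun t : ℝ => ((|g t| / |t| ^ (FracNLS.critExp N s - 1) : ℝ) : EReal))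
      (Bornology.cobounded ℝ) < ⊤)
    (u : FracNLS.Hs N s) (hu : u ∈ FracNLS.sphere N s m)
    (hmin : FracNLS.energy g u = ⨅ v ∈ FracNLS.sphere N s m, FracNLS.energy g v) :
    ∃ μ : ℝ, FracNLS.IsWeakSolution g μ u ∧ FracNLS.PohozaevIdentity g μ u ∧
      ∀ ρ : EReal,
        ρ < ((-(2 / m) : ℝ) : EReal) * (⨅ v ∈ FracNLS.sphere N s m, FracNLS.energy g v) →
        FracNLS.energy g u = FracNLS.lagrangian g m μ u ∧
        FracNLS.lagrangian g m μ u =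
          ⨅ p ∈ FracNLS.pohozaevSet N s g ρ, FracNLS.lagrangian g m p.1 p.2 := by
  open FracNLS in
  have hum : mass u = m := hu
  have hp2 := two_lt_critExp hs0 hN
  have hp := critExp_pos hs0 hN
  obtain ⟨C, hC, hgrow⟩ := exists_growth_bound hg_cont hg2
  obtain ⟨δ, hδ, hsmall⟩ := exists_mul_self_le_sq hg_zero hg1
  have hpos := lintegral_primitive_ne_top hs0 hN
    (exists_primitive_le (by linarith) hg_cont hC hgrow hδ hsmall) u
  -- The infimum is below `+∞` because a rescaled bump function has finite energy.
  have hG : Integrable fun x => primitive g (u.1 x) := by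
    refine integrable_primitive_of_energy_lt_top hg_cont hpos ?_
    obtain ⟨w, hw, hwi⟩ := exists_mem_sphere_integrable hs0 hs1.le hN hm
      (continuous_primitive hg_cont) primitive_zero
    refine (hmin.trans_le (iInf₂_le w hw)).trans_lt ?_
    rw [energy_of_integrable hwi]
    exact EReal.coe_lt_top _
  set A := kinetic u with hA
  set Γ := ∫ x, primitive g (u.1 x) with hΓ
  set p := critExp N s with hpdef
  have hEL : energy g u = lagrangian g m (2 / m * (Γ - 1 / p * A)) u := by
    rw [energy_of_integrable hG, lagrangian_of_integrable hG, hum, sub_self, mul_zero, add_zero]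
  refine ⟨2 / m * (Γ - 1 / p * A), fun φ hφ => ⟨integrable_comp_mul hs0 hN hg_cont hC hgrow hφ,
    euler_lagrange_of_minimizer hs0 hN hm hg_cont hC hgrow hum hmin hG hφ⟩, ?_, fun ρ hρ =>
    ⟨hEL, le_antisymm ?_ ?_⟩⟩
  · rw [PohozaevIdentity, extIntegral_of_integrable hG, ← EReal.coe_sub, hum, ← EReal.coe_zero,
      EReal.coe_eq_coe_iff]
    change 1 / p * A + 2 / m * (Γ - 1 / p * A) / 2 * m - Γ = 0
    field_simp
    ring
  · rw [← hEL]
    refine le_iInf₂ fun q hq => ?_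
    exact energy_le_lagrangian hs0 hN hm hg_cont hmin hG hq.2.1 hq.2.2
  · refine iInf₂_le (2 / m * (Γ - 1 / p * A), u) ⟨?_, ?_, ?_⟩
    · refine hρ.trans_le ?_
      rw [← hmin, energy_of_integrable hG, ← EReal.coe_mul, EReal.coe_le_coe_iff]
      -- Since `p > 2`, replacing `1 / p` by `1 / 2` gives `μ ≥ -(2/m) K(u)`, which exceeds `ρ`.
      have h1 : 1 / p * A ≤ 1 / 2 * A :=
        mul_le_mul_of_nonneg_right (one_div_le_one_div_of_le two_pos hp2.le) (kinetic_nonneg u)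
      have h2 : 0 < 2 / m := by positivity
      change -(2 / m) * (1 / 2 * A - Γ) ≤ 2 / m * (Γ - 1 / p * A)
      nlinarith
    · rintro rfl
      exact hm.ne (mass_zero.symm.trans hum)
    · have hi : Integrable fun x =>
          2 / m * (Γ - 1 / p * A) / 2 * (u.1 x) ^ 2 - primitive g (u.1 x) :=
        ((integrable_sq u).const_mul _).sub hG
      have e : ∫ x, (2 / m * (Γ - 1 / p * A) / 2 * (u.1 x) ^ 2 - primitive g (u.1 x))
          = 2 / m * (Γ - 1 / p * A) / 2 * m - Γ := by
        rw [integral_sub ((integrable_sq u).const_mul _) hG, integral_const_mul, ← hum, mass]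
      change ((kinetic u : ℝ) : EReal) + (critExp N s : ℝ) * extIntegral _ = 0
      rw [extIntegral_of_integrable hi, e, ← EReal.coe_mul, ← EReal.coe_add, ← EReal.coe_zero,
        EReal.coe_eq_coe_iff]
      change A + p * (2 / m * (Γ - 1 / p * A) / 2 * m - Γ) = 0
      field_simp
      ring
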